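/- All graphs are finite and simple. A geodesic of a graph is a shortest path between two of its vertices; it is maximal if it is not a subpath of another geodesic. Let $\mathrm{gt}(G)$ be the minimum cardinality of a set of vertices of $G$ that meets every maximal geodesic of $G$, and let $\mathrm{gpack}(G)$ be the maximum cardinality of a set of mutually vertex-disjoint maximal geodesics of $G$. For $r\ge 1$ let the $r$-layer hexagonal carbon nanosheet $G$ be the subgraph of the hexagonal lattice formed by a central hexagon $C$ and the $r-1$ layers of hexagons around it. For a matching $M$ of $G$, let $G_M$ be the graph obtained from $G$ by attaching one leaf to each vertex covered by $M$ and two leaves to each other vertex. A silicate sheet is a graph whose vertices are silicon and oxygen atoms, in which every edge joins a silicon and an oxygen atom, every silicon atom has degree $4$, every oxygen atom has degree $1$ or $2$, two silicon atoms have at most one common oxygen neighbour, and every silicon atom shares an oxygen atom with at most three others. For such a graph $H$, let $\mathrm{SM}(H)$ be the graph obtained by smoothing all vertices of degree $2$ (each such vertex is removed and its two neighbours are joined by an edge). $H$ is an $r$-layer hexagonal silicate sheet if deleting all pendant vertices of $\mathrm{SM}(H)$ gives a graph isomorphic to $G$. **Theorem.** Let $r\ge 1$, let $G$ be the $r$-layer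 hexagonal carbon nanosheet with central hexagon $C$, and let $M$ be the set of edges $xy$ of $G$ such that $d(x,C)=2k$ and $d(y,C)=2k+1$ for some $k\in\{0,1,\dots,r-1\}$. Let $H$ be an $r$-layer hexagonal silicate sheet. Then $$\mathrm{gpack}(H)=\mathrm{gt}(H).$$ Moreover, $M$ is a matching of $G$, $\mathrm{SM}(H)$ is isomorphic to $G_M$, $|V(G)|=6r^2$, $|M|=3(r^2-r)$, and $$\mathrm{gt}(H)=|V(G)|-|M|=6r^2-3(r^2-r)=3(r^2+r).$$ -/

import Mathlib

/-! ### Geodesics, geodesic transversals and geodesic packings -/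

namespace SimpleGraph

variable {V : Type*}

/-- A geodesic of `G`, regarded as a subgraph: the subgraph traced by a walk from some `u` to some
`v` whose length is the distance of `u` and `v` (such a walk is automatically a path). -/
def IsGeodesic (G : SimpleGraph V) (P : G.Subgraph) : Prop :=
  ∃ (u v : V) (p : G.Walk u v), p.length = G.dist u v ∧ p.toSubgraph = P

/-- A maximal geodesic: a geodesic that is not a subpath of another geodesic. -/
def IsMaximalGeodesic (G : SimpleGraph V) (P : G.Subgraph) : Prop :=
  Maximal G.IsGeodesic P

/-- A geodesic transversal: a set of vertices that meets every maximal geodesic. -/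
def IsGeodesicTransversal (G : SimpleGraph V) (S : Set V) : Prop :=
  ∀ P : G.Subgraph, G.IsMaximalGeodesic P → ∃ x ∈ S, x ∈ P.verts

/-- The geodesic transversal number of a finite graph: the minimum cardinality of a geodesic
transversal. -/
noncomputable def gt [Finite V] (G : SimpleGraph V) : ℕ :=
  sInf {n | ∃ S : Set V, G.IsGeodesicTransversal S ∧ S.ncard = n}

/-- A geodesic packing: a set of mutually vertex-disjoint maximal geodesics. -/
def IsGeodesicPacking (G : SimpleGraph V) (F : Set G.Subgraph) : Prop :=
  (∀ P ∈ F, G.IsMaximalGeodesic P) ∧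
    ∀ P ∈ F, ∀ Q ∈ F, P ≠ Q → Disjoint P.verts Q.verts

/-- The geodesic packing number of a finite graph: the maximum cardinality of a geodesic
packing. -/
noncomputable def gpack [Finite V] (G : SimpleGraph V) : ℕ :=
  sSup {n | ∃ F : Set G.Subgraph, G.IsGeodesicPacking F ∧ F.ncard = n}

/-! ### Attaching leaves, smoothing, deleting pendant vertices -/

/-- The graph `G_M`: one leaf is attached to each vertex covered by `M`, and two leaves are attached
to every other vertex. The leaves at `v` are the pairs `(v, i)`, where `i` is restricted to `0` if
`v` is covered by `M`. -/
def attachLeaves (G : SimpleGraph V) (M : G.Subgraph) :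
    SimpleGraph (V ⊕ {l : V × Fin 2 // l.1 ∈ M.verts → l.2 = 0}) where
  Adj
    | .inl u, .inl v => G.Adj u v
    | .inl u, .inr l => l.1.1 = u
    | .inr l, .inl u => l.1.1 = u
    | .inr _, .inr _ => False
  symm := ⟨by
    rintro (u | l) (v | m) h
    · exact G.adj_symm h
    · exact h
    · exact h
    · exact h⟩
  loopless := ⟨by
    rintro (u | l) h
    · exact G.irrefl h
    · exact h⟩

/-- The graph `SM(G)` obtained by smoothing all vertices of degree `2`: the vertices of degree `2`
are removed, and two distinct remaining vertices are adjacent when they are joined in `G` by a path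
all of whose interior vertices have degree `2`. -/
def smooth (G : SimpleGraph V) : SimpleGraph {v : V // (G.neighborSet v).ncard ≠ 2} where
  Adj x y := x ≠ y ∧ ∃ p : G.Walk x y, p.IsPath ∧
    ∀ v ∈ p.support, v ≠ x → v ≠ y → (G.neighborSet v).ncard = 2
  symm := ⟨by
    rintro x y ⟨hne, p, hp, h⟩
    refine ⟨hne.symm, p.reverse, hp.reverse, fun v hv hy hx => h v ?_ hx hy⟩
    simpa using hv⟩
  loopless := ⟨fun _ h => h.1 rfl⟩

/-- The graph obtained by deleting all pendant vertices (vertices of degree `1`). -/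
def deletePendants (G : SimpleGraph V) : SimpleGraph {v : V // (G.neighborSet v).ncard ≠ 1} :=
  G.comap Subtype.val

/-- The distance of the vertex `x` from the set `C` of vertices. -/
noncomputable def distToSet (G : SimpleGraph V) (x : V) (C : Set V) : ℕ :=
  sInf (G.dist x '' C)

end SimpleGraph

/-! ### Hexagonal carbon nanosheets

The hexagonal lattice is drawn in the usual cube coordinates: the centres of the hexagons are the
points `c ∈ ℤ³` with coordinate sum `0`, and the six corners of the hexagon with centre `c` are the
points `c + e` with `e ∈ {0,1}³`, `e ≠ (0,0,0)` and `e ≠ (1,1,1)`. Two corners of a hexagon are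
joined by one of its sides if they differ by `1` in exactly one coordinate. -/

/-- `c` is the centre of a hexagon that is the central hexagon (centre `0`) or lies in one of the
`r - 1` layers around it. The hexagons of the `k`-th layer around the central one are those whose
centre has coordinates with largest absolute value `k`. -/
def IsSheetCentre (r : ℕ) (c : Fin 3 → ℤ) : Prop :=
  ∑ i, c i = 0 ∧ ∀ i, |c i| < (r : ℤ)

/-- `v` is a corner of the hexagon with centre `c` (where the coordinate sum of `c` is `0`). -/
def IsHexagonCorner (c v : Fin 3 → ℤ) : Prop :=
  (∀ i, v i - c i = 0 ∨ v i - c i = 1) ∧ (∑ i, v i = 1 ∨ ∑ i, v i = 2)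

/-- The vertices of the `r`-layer hexagonal carbon nanosheet: the corners of its hexagons. -/
def NanosheetVertex (r : ℕ) : Type :=
  {v : Fin 3 → ℤ // ∃ c, IsSheetCentre r c ∧ IsHexagonCorner c v}

/-- The `r`-layer hexagonal carbon nanosheet: the union of the central hexagon and of the hexagons
in the `r - 1` layers around it. -/
def nanosheet (r : ℕ) : SimpleGraph (NanosheetVertex r) where
  Adj u v := ∑ i, |u.1 i - v.1 i| = 1 ∧
    ∃ c, IsSheetCentre r c ∧ IsHexagonCorner c u.1 ∧ IsHexagonCorner c v.1
  symm := ⟨by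
    rintro u v ⟨h, c, hc, hu, hv⟩
    refine ⟨?_, c, hc, hv, hu⟩
    simpa only [abs_sub_comm] using h⟩
  loopless := ⟨by
    rintro u ⟨h, -⟩
    simp at h⟩

/-- The vertex set of the central hexagon `C`. -/
def centralHexagon (r : ℕ) : Set (NanosheetVertex r) :=
  {v | IsHexagonCorner 0 v.1}

/-- `x` is at distance `2k` and `y` is at distance `2k + 1` from the central hexagon, for some
`k ∈ {0, …, r - 1}`. -/
def IsLayerStep (r : ℕ) (x y : NanosheetVertex r) : Prop :=
  ∃ k < r, (nanosheet r).distToSet x (centralHexagon r) = 2 * k ∧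
    (nanosheet r).distToSet y (centralHexagon r) = 2 * k + 1

/-- The layered matching `M` of the nanosheet: the edges `xy` such that, for some
`k ∈ {0, …, r - 1}`, `x` is at distance `2k` and `y` at distance `2k + 1` from the central hexagon,
together with their end-vertices. -/
def layeredMatching (r : ℕ) : (nanosheet r).Subgraph where
  verts := {x | ∃ y, (nanosheet r).Adj x y ∧ (IsLayerStep r x y ∨ IsLayerStep r y x)}
  Adj x y := (nanosheet r).Adj x y ∧ (IsLayerStep r x y ∨ IsLayerStep r y x)
  adj_sub h := h.1
  edge_vert h := ⟨_, h⟩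
  symm := ⟨fun _ _ h => ⟨h.1.symm, h.2.symm⟩⟩

/-! ### Silicate sheets -/

/-- `H` is a silicate sheet: its vertices are silicon atoms (the set `Si`) and oxygen atoms (all
others), every edge is a bond between a silicon and an oxygen atom, each silicon atom has exactly
four bonds, each oxygen atom belongs to some tetrahedron and has at most two bonds, two tetrahedra
share at most one oxygen atom, and each tetrahedron is linked to at most three others. -/
def IsSilicateSheet {V : Type*} (H : SimpleGraph V) : Prop :=
  ∃ Si : Set V,
    (∀ u v, H.Adj u v → (u ∈ Si ↔ v ∉ Si)) ∧
    (∀ s ∈ Si, (H.neighborSet s).ncard = 4) ∧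
    (∀ o ∉ Si, 1 ≤ (H.neighborSet o).ncard ∧ (H.neighborSet o).ncard ≤ 2) ∧
    (∀ s ∈ Si, ∀ t ∈ Si, s ≠ t → (H.commonNeighbors s t).Subsingleton) ∧
    (∀ s ∈ Si, {t ∈ Si | t ≠ s ∧ (H.commonNeighbors s t).Nonempty}.ncard ≤ 3)

/-- `H` is an `r`-layer hexagonal silicate sheet: a silicate sheet such that smoothing all its
vertices of degree `2` and then deleting all pendant vertices of the result gives the `r`-layer
hexagonal carbon nanosheet. -/
def IsHexagonalSilicateSheet {V : Type*} (r : ℕ) (H : SimpleGraph V) : Prop :=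
  IsSilicateSheet H ∧ Nonempty (H.smooth.deletePendants ≃g nanosheet r)

/-! A packing is never larger than a transversal, so it suffices to exhibit one of each of the same
size (`gpack_eq_and_gt_eq_of_packing_of_transversal`). Let S be the set of silicon atoms at even
distance (level) from the central hexagon.

S is a transversal. Two silicon atoms sharing an oxygen atom are neighbours in the nanosheet, and no
edge of the nanosheet joins two odd levels (`even_or_even_of_adj`). A geodesic avoiding S therefore
contains at most one silicon atom, and it can be extended unless it runs from leaf to leaf through
one silicon atom. Such an atom has degree two in the nanosheet, hence lies on an even level
(`isInterior_of_not_even`) and is in S.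

S is also the size of a packing. An atom of S with two leaves carries the geodesic between them.
Every other atom of S has degree three and is matched by M to an atom outside S; a leaf-to-leaf
geodesic runs through both. Pendant ends make these geodesics maximal, and uniqueness of partners
makes them disjoint.

In cube coordinates, level is the sum of the distances of the coordinates from {0,1}, an M-edge
changes the coordinate whose sign is opposite to the other two, and each parity class splits into
six triangles (`nonempty_equiv_level`), which gives all the counts. The silicate enters only through
its skeleton: the graph of silicon atoms is the nanosheet, and an atom has four minus its degree
leaves (`exists_isSkeleton`, `IsSkeleton.ncard_leavesAt_add`). -/

namespace SimpleGraph

/-! ### Geodesics, pendant vertices, and duality between packings and transversals -/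

variable {V : Type*} {G : SimpleGraph V}

theorem IsGeodesic.of_walk {u v : V} (p : G.Walk u v) (hp : p.length = G.dist u v) :
    G.IsGeodesic p.toSubgraph :=
  ⟨u, v, p, hp, rfl⟩

theorem IsGeodesic.verts_nonempty {P : G.Subgraph} (hP : G.IsGeodesic P) : P.verts.Nonempty := by
  obtain ⟨u, v, p, -, rfl⟩ := hP
  exact ⟨u, p.start_mem_verts_toSubgraph⟩

/-- The longer walk is a geodesic and properly contains the old one: if `w` were already on `p`, an
initial segment of `p` would reach it in fewer steps than the distance. -/
theorem not_isMaximalGeodesic_of_extend {u v w : V} (p : G.Walk u v) (h : G.Adj v w)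
    (hd : G.dist u w = p.length + 1) : ¬ G.IsMaximalGeodesic p.toSubgraph := by
  intro hm
  have hq : G.IsGeodesic (p.concat h).toSubgraph := .of_walk _ (by simp [hd])
  have hle : p.toSubgraph ≤ (p.concat h).toSubgraph := by
    rw [Walk.concat_eq_append, Walk.toSubgraph_append]
    exact le_sup_left
  have hw : w ∈ p.toSubgraph.verts :=
    (hm.2 hq hle).1 (Walk.end_mem_verts_toSubgraph _)
  rw [Walk.mem_verts_toSubgraph] at hw
  classical
  have h1 := dist_le (p.takeUntil w hw)
  have h2 := p.length_takeUntil_le_length hw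
  omega

/-- Reduces a distance computation in the silicate to excluding finitely many shapes of shorter
walks. -/
theorem dist_eq_of_length_le {u v : V} (p : G.Walk u v)
    (h : ∀ q : G.Walk u v, p.length ≤ q.length) : G.dist u v = p.length := by
  obtain ⟨q, hq⟩ := p.reachable.exists_walk_length_eq_dist
  exact le_antisymm (dist_le p) (hq ▸ h q)

/-- An interior vertex of a path already has two neighbours on the path. -/
theorem Walk.IsPath.eq_start_or_end_of_ncard_neighborSet_eq_one {a b u : V} {q : G.Walk a b}
    (hq : q.IsPath) (hu : u ∈ q.support) (h1 : (G.neighborSet u).ncard = 1) : u = a ∨ u = b := by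
  obtain ⟨i, rfl, hi⟩ := Walk.mem_support_iff_exists_getVert.1 hu
  by_contra! hne
  have h0 : i ≠ 0 := by
    rintro rfl
    simp at hne
  have hl : i < q.length := by
    refine lt_of_le_of_ne hi ?_
    rintro rfl
    simp at hne
  have h2 := hq.ncard_neighborSet_toSubgraph_internal_eq_two h0 hl
  have := Set.ncard_le_ncard (q.toSubgraph.neighborSet_subset (q.getVert i))
    (Set.finite_of_ncard_ne_zero (by omega))
  omega

/-- A geodesic that joins two different vertices of degree one is maximal. -/
theorem isMaximalGeodesic_of_ncard_neighborSet_eq_one {u v : V} (p : G.Walk u v)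
    (hp : p.length = G.dist u v) (huv : u ≠ v) (hu : (G.neighborSet u).ncard = 1)
    (hv : (G.neighborSet v).ncard = 1) : G.IsMaximalGeodesic p.toSubgraph := by
  refine ⟨.of_walk p hp, ?_⟩
  rintro _ ⟨a, b, q, hq, rfl⟩ hle
  have hpP := p.isPath_of_length_eq_dist hp
  have hqP := q.isPath_of_length_eq_dist hq
  have hu' := hqP.eq_start_or_end_of_ncard_neighborSet_eq_one
    (q.mem_verts_toSubgraph.1 (hle.1 p.start_mem_verts_toSubgraph)) hu
  have hv' := hqP.eq_start_or_end_of_ncard_neighborSet_eq_one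
    (q.mem_verts_toSubgraph.1 (hle.1 p.end_mem_verts_toSubgraph)) hv
  -- Both pendant vertices must be ends of `q`, so `p` and `q` realise the same distance. Equal
  -- length then forces the edges and vertices of `q` to be those of `p`, by counting.
  have hlen : q.length = p.length := by
    rw [hp, hq]
    rcases hu' with rfl | rfl <;> rcases hv' with rfl | rfl
    · exact absurd rfl huv
    · rfl
    · exact dist_comm
    · exact absurd rfl huv
  have hedges : q.edges ⊆ p.edges := by
    have hsub : p.edges ⊆ q.edges := fun e he =>
      q.mem_edges_toSubgraph.1 (Subgraph.edgeSet_mono hle (p.mem_edges_toSubgraph.2 he))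
    exact ((List.subperm_of_subset hpP.edges_nodup hsub).perm_of_length_le (by simp [hlen])).symm.subset
  have hsupp : q.support ⊆ p.support := by
    have hsub : p.support ⊆ q.support := fun e he =>
      q.mem_verts_toSubgraph.1 (hle.1 (p.mem_verts_toSubgraph.2 he))
    exact ((List.subperm_of_subset hpP.support_nodup hsub).perm_of_length_le
      (by simp [hlen])).symm.subset
  refine ⟨fun x hx => p.mem_verts_toSubgraph.2 (hsupp (q.mem_verts_toSubgraph.1 hx)), ?_⟩
  intro x y hxy
  rw [Walk.adj_toSubgraph_iff_mem_edges] at hxy ⊢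
  exact hedges hxy

/-- Choose a point of `S` on each member of `F`; disjointness makes the choice injective. -/
theorem IsGeodesicPacking.ncard_le [Finite V] {F : Set G.Subgraph} (hF : G.IsGeodesicPacking F)
    {S : Set V} (hS : G.IsGeodesicTransversal S) : F.ncard ≤ S.ncard := by
  obtain rfl | ⟨P₀, hP₀⟩ := F.eq_empty_or_nonempty
  · simp
  have : Nonempty V := (hF.1 P₀ hP₀).1.verts_nonempty.to_type
  choose! f hf using fun P (hP : P ∈ F) => hS P (hF.1 P hP)
  refine Set.ncard_le_ncard_of_injOn f (fun P hP => (hf P hP).1) ?_ S.toFinite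
  intro P hP Q hQ h
  by_contra hne
  exact Set.disjoint_left.1 (hF.2 P hP Q hQ hne) (hf P hP).2 (h ▸ (hf Q hQ).2)

/-- A geodesic packing and a geodesic transversal of equal size determine `gpack` and `gt`. -/
theorem gpack_eq_and_gt_eq_of_packing_of_transversal [Finite V] {F : Set G.Subgraph}
    (hF : G.IsGeodesicPacking F) {S : Set V} (hS : G.IsGeodesicTransversal S)
    (h : F.ncard = S.ncard) : G.gpack = S.ncard ∧ G.gt = S.ncard := by
  constructor
  · refine IsGreatest.csSup_eq ⟨⟨F, hF, h⟩, ?_⟩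
    rintro _ ⟨F', hF', rfl⟩
    exact hF'.ncard_le hS
  · refine IsLeast.csInf_eq ⟨⟨S, hS, rfl⟩, ?_⟩
    rintro _ ⟨S', hS', rfl⟩
    exact h ▸ hF.ncard_le hS'

/-- A family of mutually disjoint maximal geodesics is a geodesic packing. -/
theorem isGeodesicPacking_range {ι : Type*} {P : ι → G.Subgraph}
    (hP : ∀ i, G.IsMaximalGeodesic (P i))
    (hd : ∀ i j, i ≠ j → Disjoint (P i).verts (P j).verts) :
    G.IsGeodesicPacking (Set.range P) ∧ (Set.range P).ncard = Nat.card ι := by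
  have hinj : Function.Injective P := by
    intro i j hij
    by_contra hne
    obtain ⟨x, hx⟩ := (hP i).1.verts_nonempty
    exact Set.disjoint_left.1 (hd i j hne) hx (hij ▸ hx)
  refine ⟨⟨?_, ?_⟩, ?_⟩
  · rintro _ ⟨i, rfl⟩
    exact hP i
  · rintro _ ⟨i, rfl⟩ _ ⟨j, rfl⟩ hne
    exact hd i j fun h => hne (h ▸ rfl)
  · rw [← Set.image_univ, Set.ncard_image_of_injective _ hinj, Set.ncard_univ]

end SimpleGraph

/-! ### Maximal geodesics in a silicate -/

namespace SimpleGraph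

variable {V : Type*}

/-- The vertices of degree one that are adjacent to `s`. -/
def leavesAt (H : SimpleGraph V) (s : V) : Set V :=
  {o | H.Adj s o ∧ (H.neighborSet o).ncard = 1}

/-- `Si` is the set of silicon atoms of the silicate `H`. -/
structure IsSiliconSet (H : SimpleGraph V) (Si : Set V) : Prop where
  mem_iff : ∀ u v, H.Adj u v → (u ∈ Si ↔ v ∉ Si)
  ncard_eq_four : ∀ s ∈ Si, (H.neighborSet s).ncard = 4
  one_le_ncard : ∀ o ∉ Si, 1 ≤ (H.neighborSet o).ncard
  ncard_le_two : ∀ o ∉ Si, (H.neighborSet o).ncard ≤ 2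
  subsingleton : ∀ s ∈ Si, ∀ t ∈ Si, s ≠ t → (H.commonNeighbors s t).Subsingleton

theorem _root_.IsSilicateSheet.exists_isSiliconSet {H : SimpleGraph V} (hH : IsSilicateSheet H) :
    ∃ Si : Set V, H.IsSiliconSet Si := by
  obtain ⟨Si, h1, h2, h3, h4, -⟩ := hH
  exact ⟨Si, h1, h2, fun o ho => (h3 o ho).1, fun o ho => (h3 o ho).2, h4⟩

theorem eq_of_adj_of_ncard_neighborSet_eq_one {H : SimpleGraph V} {o s t : V}
    (ho : (H.neighborSet o).ncard = 1) (hs : H.Adj o s) (ht : H.Adj o t) : s = t := by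
  obtain ⟨a, ha⟩ := Set.ncard_eq_one.1 ho
  have h1 : s ∈ H.neighborSet o := hs
  have h2 : t ∈ H.neighborSet o := ht
  rw [ha] at h1 h2
  exact h1.trans h2.symm

namespace IsSiliconSet

variable {H : SimpleGraph V} {Si : Set V}

theorem notMem_of_adj (h : H.IsSiliconSet Si) {s o : V} (hs : s ∈ Si) (ha : H.Adj s o) : o ∉ Si :=
  (h.mem_iff s o ha).1 hs

theorem mem_of_adj (h : H.IsSiliconSet Si) {o s : V} (ho : o ∉ Si) (ha : H.Adj o s) : s ∈ Si := by
  by_contra hs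
  exact ho ((h.mem_iff o s ha).2 hs)

theorem eq_of_common (h : H.IsSiliconSet Si) {s t o o' : V} (hs : s ∈ Si) (ht : t ∈ Si)
    (hst : s ≠ t) (h1 : H.Adj s o) (h2 : H.Adj t o) (h3 : H.Adj s o') (h4 : H.Adj t o') : o = o' :=
  h.subsingleton s hs t ht hst ⟨h1, h2⟩ ⟨h3, h4⟩

theorem exists_adj_ne (h : H.IsSiliconSet Si) {s : V} (hs : s ∈ Si) (o : V) :
    ∃ o', H.Adj s o' ∧ o' ≠ o :=
  Set.exists_ne_of_one_lt_ncard (s := H.neighborSet s)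
    (by rw [h.ncard_eq_four s hs]; norm_num) o

theorem exists_adj (h : H.IsSiliconSet Si) (u : V) : ∃ v, H.Adj u v := by
  by_cases hu : u ∈ Si
  · exact (h.exists_adj_ne hu u).imp fun _ hv => hv.1
  · exact Set.nonempty_of_ncard_ne_zero (s := H.neighborSet u) (by have := h.one_le_ncard u hu; omega)

theorem ncard_eq_two (h : H.IsSiliconSet Si) {o : V} (ho : o ∉ Si)
    (h1 : (H.neighborSet o).ncard ≠ 1) : (H.neighborSet o).ncard = 2 := by
  have := h.one_le_ncard o ho
  have := h.ncard_le_two o ho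
  omega

theorem exists_other (h : H.IsSiliconSet Si) {o s : V} (ho : o ∉ Si)
    (h1 : (H.neighborSet o).ncard ≠ 1) : ∃ t, H.Adj o t ∧ t ≠ s :=
  Set.exists_ne_of_one_lt_ncard (s := H.neighborSet o)
    (by rw [h.ncard_eq_two ho h1]; norm_num) s

theorem ncard_eq_two_of_adj [Finite V] (h : H.IsSiliconSet Si) {o s t : V} (ho : o ∉ Si)
    (hs : H.Adj o s) (ht : H.Adj o t) (hst : s ≠ t) : (H.neighborSet o).ncard = 2 :=
  h.ncard_eq_two ho fun h1 => hst (eq_of_adj_of_ncard_neighborSet_eq_one h1 hs ht)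

theorem eq_or_eq_of_adj [Finite V] (h : H.IsSiliconSet Si) {o s t u : V} (ho : o ∉ Si)
    (hs : H.Adj o s) (ht : H.Adj o t) (hst : s ≠ t) (hu : H.Adj o u) : u = s ∨ u = t := by
  have hsub : ({s, t} : Set V) ⊆ H.neighborSet o := by
    rintro x (rfl | rfl)
    · exact hs
    · exact ht
  have heq := Set.eq_of_subset_of_ncard_le hsub
    (by rw [Set.ncard_pair hst]; exact h.ncard_le_two o ho)
  have hu' : u ∈ H.neighborSet o := hu
  rw [← heq] at hu'
  exact hu'

/-- A vertex cover (with respect to sharing oxygen atoms) of the silicon atoms that contains all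
silicon atoms with two leaves is a geodesic transversal. -/
theorem isGeodesicTransversal (h : H.IsSiliconSet Si) {S : Set V}
    (hcover : ∀ s ∈ Si, ∀ t ∈ Si, ∀ o, s ≠ t → H.Adj s o → H.Adj o t → s ∈ S ∨ t ∈ S)
    (hleaves : ∀ s ∈ Si, (H.leavesAt s).Nontrivial → s ∈ S) : H.IsGeodesicTransversal S := by
  intro P hP
  by_contra! hS
  obtain ⟨u, v, p, hp, rfl⟩ := hP.1
  have hpath := p.isPath_of_length_eq_dist hp
  simp only [Walk.mem_verts_toSubgraph] at hS
  -- An oxygen–silicon–oxygen path extends whenever its last oxygen atom is a bridge to another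
  -- silicon atom `t`. A direct bond from `o` to `t` would give `s` and `t` two common oxygen atoms;
  -- lengths 0 and 2 fail by bipartiteness.
  have ext2 {o s o' t : V} (h1 : H.Adj o s) (h2 : H.Adj s o') (h3 : H.Adj o' t) (hs : s ∈ Si)
      (hoo : o ≠ o') (hst : t ≠ s) : ¬ H.IsMaximalGeodesic
        (Walk.cons h1 (Walk.cons h2 Walk.nil)).toSubgraph := by
    have ho := h.notMem_of_adj hs h1.symm
    have ho' := h.notMem_of_adj hs h2
    have ht := h.mem_of_adj ho' h3
    refine not_isMaximalGeodesic_of_extend _ h3 ?_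
    refine dist_eq_of_length_le (Walk.cons h1 (Walk.cons h2 (Walk.cons h3 Walk.nil))) ?_
    intro q
    rcases q with _ | ⟨a, _ | ⟨b, _ | ⟨c, q⟩⟩⟩
    · exact absurd ht ho
    · exact absurd (h.eq_of_common hs ht hst.symm h1.symm a.symm h2 h3.symm) hoo
    · exact absurd ht (h.notMem_of_adj (h.mem_of_adj ho a) b)
    · simp
  have ext1 {o s : V} (h1 : H.Adj o s) (hs : s ∈ Si) : ¬ H.IsMaximalGeodesic
        (Walk.cons h1 Walk.nil).toSubgraph := by
    obtain ⟨o', h2, hne⟩ := h.exists_adj_ne hs o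
    have ho := h.notMem_of_adj hs h1.symm
    have ho' := h.notMem_of_adj hs h2
    refine not_isMaximalGeodesic_of_extend _ h2 ?_
    refine dist_eq_of_length_le (Walk.cons h1 (Walk.cons h2 Walk.nil)) ?_
    intro q
    rcases q with _ | ⟨a, _ | ⟨b, q⟩⟩
    · exact absurd rfl hne
    · exact absurd (h.mem_of_adj ho a) ho'
    · simp
  match p with
  | .nil =>
    obtain ⟨w, hw⟩ := h.exists_adj u
    exact not_isMaximalGeodesic_of_extend Walk.nil hw (by simpa using dist_eq_one_iff_adj.2 hw) hP
  | .cons a .nil =>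
    by_cases hu : u ∈ Si
    · refine ext1 a.symm hu ?_
      have := Walk.toSubgraph_reverse (Walk.cons a Walk.nil)
      simp only [Walk.reverse_cons, Walk.reverse_nil, Walk.nil_append] at this
      rw [this]
      exact hP
    · exact ext1 a (h.mem_of_adj hu a) hP
  -- The only length at which a maximal geodesic can have just one silicon atom: both ends must then
  -- be leaves, and `hleaves` applies.
  | .cons (v := s) a (.cons b .nil) =>
    simp only [Walk.cons_isPath_iff, Walk.support_cons, Walk.support_nil, List.mem_cons,
      List.not_mem_nil, or_false, not_or] at hpath
    by_cases hu : u ∈ Si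
    · have hs := h.notMem_of_adj hu a
      have hv := h.mem_of_adj hs b
      rcases hcover u hu v hv s hpath.2.2 a b with h1 | h1
      · exact hS _ h1 (by simp)
      · exact hS _ h1 (by simp)
    · have hs := h.mem_of_adj hu a
      have hv := h.notMem_of_adj hs b
      by_cases h1 : (H.neighborSet u).ncard = 1
      · by_cases h2 : (H.neighborSet v).ncard = 1
        · exact hS _ (hleaves s hs ⟨u, ⟨a.symm, h1⟩, v, ⟨b, h2⟩, hpath.2.2⟩) (by simp)
        · obtain ⟨t, ht, hts⟩ := h.exists_other (s := s) hv h2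
          exact ext2 a b ht hs hpath.2.2 hts hP
      · obtain ⟨t, ht, hts⟩ := h.exists_other (s := s) hu h1
        refine ext2 b.symm a.symm ht hs (Ne.symm hpath.2.2) hts ?_
        have := Walk.toSubgraph_reverse (Walk.cons a (Walk.cons b Walk.nil))
        simp only [Walk.reverse_cons, Walk.reverse_nil, Walk.nil_append, Walk.cons_append] at this
        rw [this]
        exact hP
  -- From length three on, the first four vertices contain two silicon atoms around a common oxygen
  -- atom, one of which the cover catches.
  | .cons (v := x) a (.cons (v := y) b (.cons (v := z) c q)) =>
    have hz : z ∈ q.support := q.start_mem_support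
    simp only [Walk.cons_isPath_iff, Walk.support_cons, List.mem_cons, not_or] at hpath
    by_cases hu : u ∈ Si
    · have hx := h.notMem_of_adj hu a
      have hy := h.mem_of_adj hx b
      rcases hcover u hu y hy x hpath.2.2.1 a b with h1 | h1
      · exact hS _ h1 (by simp)
      · exact hS _ h1 (by simp)
    · have hx := h.mem_of_adj hu a
      have hy := h.notMem_of_adj hx b
      have hxz : x ≠ z := by
        rintro rfl
        exact hpath.1.2.2 hz
      rcases hcover x hx z (h.mem_of_adj hy c) y hxz b c with h1 | h1
      · exact hS _ h1 (by simp)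
      · exact hS _ h1 (by simp)

/-- The geodesic through a silicon atom between two of its leaves. -/
theorem exists_isMaximalGeodesic_of_nontrivial (h : H.IsSiliconSet Si) {s : V} (hs : s ∈ Si)
    (hl : (H.leavesAt s).Nontrivial) : ∃ P : H.Subgraph, H.IsMaximalGeodesic P ∧
      ∀ w ∈ P.verts, (w ∈ Si → w = s) ∧ (w ∉ Si → ∀ u, H.Adj w u → u = s) := by
  obtain ⟨o, ⟨ho, ho1⟩, o', ⟨ho', ho1'⟩, hne⟩ := hl
  refine ⟨(Walk.cons ho.symm (Walk.cons ho' Walk.nil)).toSubgraph,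
    isMaximalGeodesic_of_ncard_neighborSet_eq_one _ ?_ hne ho1 ho1', ?_⟩
  · refine (dist_eq_of_length_le _ ?_).symm
    intro q
    rcases q with _ | ⟨a, _ | ⟨b, q⟩⟩
    · exact absurd rfl hne
    · exact absurd (h.mem_of_adj (h.notMem_of_adj hs ho) a) (h.notMem_of_adj hs ho')
    · simp
  · intro w hw
    simp only [Walk.mem_verts_toSubgraph, Walk.support_cons, Walk.support_nil, List.mem_cons,
      List.not_mem_nil, or_false] at hw
    rcases hw with rfl | rfl | rfl
    · exact ⟨fun hw => absurd hw (h.notMem_of_adj hs ho),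
        fun _ u hu => eq_of_adj_of_ncard_neighborSet_eq_one ho1 hu ho.symm⟩
    · exact ⟨fun _ => rfl, fun hw => absurd hs hw⟩
    · exact ⟨fun hw => absurd hw (h.notMem_of_adj hs ho'),
        fun _ u hu => eq_of_adj_of_ncard_neighborSet_eq_one ho1' hu ho'.symm⟩

/-- The geodesic between leaves of two silicon atoms that share an oxygen atom. -/
theorem exists_isMaximalGeodesic_of_common [Finite V] (h : H.IsSiliconSet Si) {s t b : V}
    (hs : s ∈ Si) (ht : t ∈ Si) (hst : s ≠ t) (hsb : H.Adj s b) (hbt : H.Adj b t)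
    (hls : (H.leavesAt s).Nonempty) (hlt : (H.leavesAt t).Nonempty) :
    ∃ P : H.Subgraph, H.IsMaximalGeodesic P ∧
      ∀ w ∈ P.verts, (w ∈ Si → w = s ∨ w = t) ∧ (w ∉ Si → ∀ u, H.Adj w u → u = s ∨ u = t) := by
  obtain ⟨o, ho, ho1⟩ := hls
  obtain ⟨o', ho', ho1'⟩ := hlt
  have hoSi := h.notMem_of_adj hs ho
  have hoSi' := h.notMem_of_adj ht ho'
  have hne : o ≠ o' := by
    rintro rfl
    exact hst (eq_of_adj_of_ncard_neighborSet_eq_one ho1 ho.symm ho'.symm)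
  refine ⟨(Walk.cons ho.symm (Walk.cons hsb (Walk.cons hbt (Walk.cons ho' Walk.nil)))).toSubgraph,
    isMaximalGeodesic_of_ncard_neighborSet_eq_one _ ?_ hne ho1 ho1', ?_⟩
  · refine (dist_eq_of_length_le _ ?_).symm
    intro q
    rcases q with _ | ⟨a, _ | ⟨b, _ | ⟨c, _ | ⟨d, q⟩⟩⟩⟩
    · exact absurd rfl hne
    · exact absurd (h.mem_of_adj hoSi a) hoSi'
    -- The middle vertex of a walk of length two would be the unique neighbour of both leaves,
    -- forcing `s = t`.
    · have h1 := eq_of_adj_of_ncard_neighborSet_eq_one ho1 a ho.symm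
      have h2 := eq_of_adj_of_ncard_neighborSet_eq_one ho1' b.symm ho'.symm
      exact absurd (h1.symm.trans h2) hst
    · exact absurd (h.mem_of_adj (h.notMem_of_adj (h.mem_of_adj hoSi a) b) c) hoSi'
    · simp
  · intro w hw
    simp only [Walk.mem_verts_toSubgraph, Walk.support_cons, Walk.support_nil, List.mem_cons,
      List.not_mem_nil, or_false] at hw
    rcases hw with rfl | rfl | rfl | rfl | rfl
    · exact ⟨fun hw => absurd hw hoSi,
        fun _ u hu => .inl (eq_of_adj_of_ncard_neighborSet_eq_one ho1 hu ho.symm)⟩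
    · exact ⟨fun _ => .inl rfl, fun hw => absurd hs hw⟩
    · have hw := h.notMem_of_adj hs hsb
      exact ⟨fun hw' => absurd hw' hw, fun _ u hu => h.eq_or_eq_of_adj hw hsb.symm hbt hst hu⟩
    · exact ⟨fun _ => .inr rfl, fun hw => absurd ht hw⟩
    · exact ⟨fun hw => absurd hw hoSi',
        fun _ u hu => .inr (eq_of_adj_of_ncard_neighborSet_eq_one ho1' hu ho'.symm)⟩

/-- A vertex cover of the silicon atoms that contains all silicon atoms with two leaves, and whose
other members are matched with silicon atoms outside the cover, determines `gpack` and `gt`. -/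
theorem gpack_eq_and_gt_eq [Finite V] (h : H.IsSiliconSet Si) {S : Set V} (hSSi : S ⊆ Si)
    (hcover : ∀ s ∈ Si, ∀ t ∈ Si, ∀ o, s ≠ t → H.Adj s o → H.Adj o t → s ∈ S ∨ t ∈ S)
    (hleaves : ∀ s ∈ Si, (H.leavesAt s).Nontrivial → s ∈ S)
    (hleaf : ∀ s ∈ Si, (H.leavesAt s).Nonempty) (R : V → V → Prop)
    (hR : ∀ s ∈ S, ∀ s' ∈ S, ∀ t, R s t → R s' t → s = s')
    (hmatch : ∀ s ∈ S, (H.leavesAt s).Nontrivial ∨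
      ∃ t ∈ Si, t ∉ S ∧ R s t ∧ ∃ o, H.Adj s o ∧ H.Adj o t) :
    H.gpack = S.ncard ∧ H.gt = S.ncard := by
  -- For an oxygen atom on the geodesic, all of its silicon neighbours are controlled. Hence two
  -- geodesics that meet in an oxygen atom can be compared at any one of its neighbours, just as if
  -- they met in a silicon atom.
  have key : ∀ s : S, ∃ P : H.Subgraph, H.IsMaximalGeodesic P ∧ ∀ w ∈ P.verts,
      (w ∈ Si → w = s ∨ w ∉ S ∧ R s w) ∧
      (w ∉ Si → ∀ u, H.Adj w u → u = s ∨ u ∉ S ∧ R s u) := by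
    rintro ⟨s, hs⟩
    rcases hmatch s hs with hl | ⟨t, ht, htS, hRt, o, h1, h2⟩
    · obtain ⟨P, hP, hw⟩ := h.exists_isMaximalGeodesic_of_nontrivial (hSSi hs) hl
      exact ⟨P, hP, fun w hwP => ⟨fun h1 => .inl ((hw w hwP).1 h1),
        fun h1 u hu => .inl ((hw w hwP).2 h1 u hu)⟩⟩
    · have hst : s ≠ t := by
        rintro rfl
        exact htS hs
      obtain ⟨P, hP, hw⟩ := h.exists_isMaximalGeodesic_of_common (hSSi hs) ht hst h1 h2
        (hleaf s (hSSi hs)) (hleaf t ht)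
      refine ⟨P, hP, fun w hwP => ⟨fun h1 => ?_, fun h1 u hu => ?_⟩⟩
      · rcases (hw w hwP).1 h1 with rfl | rfl
        · exact .inl rfl
        · exact .inr ⟨htS, hRt⟩
      · rcases (hw w hwP).2 h1 u hu with rfl | rfl
        · exact .inl rfl
        · exact .inr ⟨htS, hRt⟩
  choose P hP hw using key
  -- Membership in `S` decides whether `w` is the index itself or its partner, so mixed cases are
  -- impossible; a common partner is excluded by `hR`.
  have haux : ∀ (i j : S) (w : V), (w = i ∨ w ∉ S ∧ R i w) → (w = j ∨ w ∉ S ∧ R j w) → i = j := by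
    rintro ⟨i, hi⟩ ⟨j, hj⟩ w (rfl | ⟨h1, h2⟩) (h3 | ⟨h3, h4⟩)
    · exact Subtype.ext h3
    · exact absurd hi h3
    · exact absurd (h3 ▸ hj) h1
    · exact Subtype.ext (hR i hi j hj w h2 h4)
  obtain ⟨hF, hcard⟩ := isGeodesicPacking_range hP fun i j hij => by
    refine Set.disjoint_left.2 fun w hwi hwj => hij ?_
    by_cases hwS : w ∈ Si
    · exact haux i j w ((hw i w hwi).1 hwS) ((hw j w hwj).1 hwS)
    · obtain ⟨u, hu⟩ := h.exists_adj w
      exact haux i j u ((hw i w hwi).2 hwS u hu) ((hw j w hwj).2 hwS u hu)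
  exact gpack_eq_and_gt_eq_of_packing_of_transversal hF
    (h.isGeodesicTransversal hcover hleaves) hcard

end IsSiliconSet

end SimpleGraph

/-! ### Smoothing a silicate and recovering its skeleton -/

namespace SimpleGraph

namespace IsSiliconSet

variable {V : Type*} {H : SimpleGraph V} {Si : Set V}

theorem ncard_ne_two (h : H.IsSiliconSet Si) {s : V} (hs : s ∈ Si) :
    (H.neighborSet s).ncard ≠ 2 := by
  rw [h.ncard_eq_four s hs]
  norm_num

theorem notMem_of_ncard_eq_one (h : H.IsSiliconSet Si) {o : V}
    (ho : (H.neighborSet o).ncard = 1) : o ∉ Si := fun hs => by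
  rw [h.ncard_eq_four o hs] at ho
  norm_num at ho

theorem notMem_of_ncard_eq_two (h : H.IsSiliconSet Si) {o : V}
    (ho : (H.neighborSet o).ncard = 2) : o ∉ Si := fun hs => h.ncard_ne_two hs ho

theorem ncard_eq_one (h : H.IsSiliconSet Si) {o : V} (ho : o ∉ Si)
    (h2 : (H.neighborSet o).ncard ≠ 2) : (H.neighborSet o).ncard = 1 := by
  by_contra h1
  exact h2 (h.ncard_eq_two ho h1)

/-- Vertices of degree two are oxygen atoms, and oxygen atoms are never adjacent, so a smoothed path
has at most one interior vertex. -/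
theorem smooth_adj_iff (h : H.IsSiliconSet Si) (x y : {v : V // (H.neighborSet v).ncard ≠ 2}) :
    H.smooth.Adj x y ↔ H.Adj x y ∨
      (x ≠ y ∧ ∃ o, (H.neighborSet o).ncard = 2 ∧ H.Adj x o ∧ H.Adj o y) := by
  obtain ⟨x, hx⟩ := x
  obtain ⟨y, hy⟩ := y
  constructor
  · rintro ⟨hne, p, hp, hdeg⟩
    rw [Ne, Subtype.mk.injEq] at hne
    simp only at p hp hdeg
    rcases p with _ | ⟨a, _ | ⟨b, _ | ⟨c, q⟩⟩⟩
    · exact absurd rfl hne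
    · exact .inl a
    · rename_i o
      refine .inr ⟨by simpa using hne, o, hdeg o (by simp) a.ne' b.ne, a, b⟩
    · rename_i u v w
      have hw : w ∈ q.support := q.start_mem_support
      have hyq : y ∈ q.support := q.end_mem_support
      simp only [Walk.cons_isPath_iff, Walk.support_cons, List.mem_cons, not_or] at hp
      have hu := hdeg u (by simp) (Ne.symm hp.2.1) (by rintro rfl; exact hp.1.2.2 hyq)
      have hv := hdeg v (by simp) (Ne.symm hp.2.2.1) (by rintro rfl; exact hp.1.1.2 hyq)
      exact absurd (h.mem_of_adj (h.notMem_of_ncard_eq_two hu) b) (h.notMem_of_ncard_eq_two hv)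
  · rintro (a | ⟨hne, o, ho, a, b⟩)
    · refine ⟨by simpa using a.ne, Walk.cons a Walk.nil, by simpa using a.ne, ?_⟩
      intro v hv h1 h2
      simp_all
    · have hne' : x ≠ y := by simpa using hne
      refine ⟨hne, Walk.cons a (Walk.cons b Walk.nil), ?_, ?_⟩
      · simp only [Walk.cons_isPath_iff, Walk.support_cons, Walk.support_nil, List.mem_cons,
          List.not_mem_nil, or_false, not_or]
        exact ⟨⟨Walk.IsPath.nil, b.ne⟩, a.ne, hne'⟩
      · intro v hv h1 h2
        simp only [Walk.support_cons, Walk.support_nil, List.mem_cons,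
          List.not_mem_nil, or_false] at hv
        rcases hv with rfl | rfl | rfl
        · exact absurd rfl h1
        · exact ho
        · exact absurd rfl h2

theorem ncard_smooth_neighborSet_of_notMem [Finite V] (h : H.IsSiliconSet Si)
    (x : {v : V // (H.neighborSet v).ncard ≠ 2}) (hx : x.1 ∉ Si) :
    (H.smooth.neighborSet x).ncard = 1 := by
  obtain ⟨s, hs⟩ := h.exists_adj x.1
  have h1 := h.ncard_eq_one hx x.2
  have hsSi := h.mem_of_adj hx hs
  rw [Set.ncard_eq_one]
  refine ⟨⟨s, h.ncard_ne_two hsSi⟩, ?_⟩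
  ext y
  rw [mem_neighborSet, h.smooth_adj_iff, Set.mem_singleton_iff]
  constructor
  · rintro (a | ⟨-, o, ho, a, b⟩)
    · exact Subtype.ext (eq_of_adj_of_ncard_neighborSet_eq_one h1 a hs)
    · exact absurd (h.mem_of_adj hx a) (h.notMem_of_ncard_eq_two ho)
  · rintro rfl
    exact .inl hs

/-- Every bond of a silicon atom yields a neighbour after smoothing, either the leaf itself or the
silicon atom across the bridge. Two bonds yield different neighbours, since two tetrahedra share at
most one oxygen atom. -/
theorem ncard_smooth_neighborSet_of_mem [Finite V] (h : H.IsSiliconSet Si)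
    (x : {v : V // (H.neighborSet v).ncard ≠ 2}) (hx : x.1 ∈ Si) :
    (H.smooth.neighborSet x).ncard ≠ 1 := by
  intro h1
  obtain ⟨a, ha⟩ := Set.ncard_eq_one.1 h1
  have key : ∀ o, H.Adj x o → o = a.1 ∨ (a.1 ∈ Si ∧ x ≠ a ∧ H.Adj o a.1) := by
    intro o ho
    have hoSi := h.notMem_of_adj hx ho
    by_cases h2 : (H.neighborSet o).ncard = 2
    · obtain ⟨t, ht, hne⟩ := h.exists_other (s := x.1) hoSi (by omega)
      have htSi := h.mem_of_adj hoSi ht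
      have hmem : (⟨t, h.ncard_ne_two htSi⟩ : {v : V // (H.neighborSet v).ncard ≠ 2}) ∈
          H.smooth.neighborSet x := by
        rw [mem_neighborSet, h.smooth_adj_iff]
        refine .inr ⟨fun he => hne ?_, o, h2, ho, ht⟩
        rw [he]
      rw [ha] at hmem
      have := Set.mem_singleton_iff.1 hmem
      subst this
      refine .inr ⟨htSi, fun he => hne ?_, ht⟩
      rw [he]
    · have hmem : (⟨o, h2⟩ : {v : V // (H.neighborSet v).ncard ≠ 2}) ∈
          H.smooth.neighborSet x := by
        rw [mem_neighborSet, h.smooth_adj_iff]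
        exact .inl ho
      rw [ha] at hmem
      have := Set.mem_singleton_iff.1 hmem
      subst this
      exact .inl rfl
  obtain ⟨o, ho, -⟩ := h.exists_adj_ne hx x.1
  obtain ⟨o', ho', hne⟩ := h.exists_adj_ne hx o
  rcases key o ho with h2 | ⟨h2, h3, h4⟩ <;> rcases key o' ho' with h5 | ⟨h5, h6, h7⟩
  · exact hne (h5.trans h2.symm)
  · exact h.notMem_of_adj hx ho (h2 ▸ h5)
  · exact h.notMem_of_adj hx ho' (h5 ▸ h2)
  · exact hne (h.eq_of_common hx h2 (fun he => h3 (Subtype.ext he)) ho' h7.symm ho h4.symm)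

/-- Each of the four oxygen atoms is a leaf or a bridge, and bridges correspond bijectively to
linked silicon atoms because no two tetrahedra share two oxygen atoms. -/
theorem ncard_leavesAt_add [Finite V] (h : H.IsSiliconSet Si) {s : V} (hs : s ∈ Si) :
    (H.leavesAt s).ncard +
      {t | t ∈ Si ∧ t ≠ s ∧ ∃ o, H.Adj s o ∧ H.Adj o t}.ncard = 4 := by
  have hunion : H.neighborSet s =
      H.leavesAt s ∪ {o | H.Adj s o ∧ (H.neighborSet o).ncard = 2} := by
    ext o
    simp only [mem_neighborSet, leavesAt, Set.mem_union, Set.mem_ofPred_eq]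
    constructor
    · intro ho
      by_cases h1 : (H.neighborSet o).ncard = 1
      · exact .inl ⟨ho, h1⟩
      · exact .inr ⟨ho, h.ncard_eq_two (h.notMem_of_adj hs ho) h1⟩
    · rintro (ho | ho) <;> exact ho.1
  have hdisj : Disjoint (H.leavesAt s) {o | H.Adj s o ∧ (H.neighborSet o).ncard = 2} := by
    refine Set.disjoint_left.2 fun o ho ho' => ?_
    have h1 := ho.2
    have h2 := ho'.2
    omega
  rw [← h.ncard_eq_four s hs, hunion, Set.ncard_union_eq hdisj (Set.toFinite _) (Set.toFinite _)]
  congr 1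
  symm
  have hex : ∀ o, H.Adj s o ∧ (H.neighborSet o).ncard = 2 → ∃ t, H.Adj o t ∧ t ≠ s := by
    rintro o ⟨ho, h2⟩
    exact h.exists_other (h.notMem_of_adj hs ho) (by omega)
  have : Nonempty V := ⟨s⟩
  choose! f hf using hex
  refine Set.ncard_congr (fun o _ => f o) ?_ ?_ ?_
  · intro o ho
    have hoSi := h.notMem_of_adj hs ho.1
    exact ⟨h.mem_of_adj hoSi (hf o ho).1, (hf o ho).2, o, ho.1, (hf o ho).1⟩
  · intro o o' ho ho' he
    have hoSi := h.notMem_of_adj hs ho.1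
    have h1 := (hf o' ho').1.symm
    rw [← he] at h1
    exact h.eq_of_common hs (h.mem_of_adj hoSi (hf o ho).1) (hf o ho).2.symm ho.1 (hf o ho).1.symm
      ho'.1 h1
  · rintro t ⟨-, hne, o, h1, h2⟩
    have hoSi := h.notMem_of_adj hs h1
    have ho : H.Adj s o ∧ (H.neighborSet o).ncard = 2 :=
      ⟨h1, h.ncard_eq_two_of_adj hoSi h1.symm h2 hne.symm⟩
    refine ⟨o, ho, ?_⟩
    exact (h.eq_or_eq_of_adj hoSi h1.symm h2 hne.symm (hf o ho).1).resolve_left (hf o ho).2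

/-- `G` is the graph of the silicon atoms of `H`, where sharing an oxygen atom is adjacency, and
`σ` tells which vertex of `G` is which silicon atom. -/
structure IsSkeleton {W : Type*} (H : SimpleGraph V) (Si : Set V) (G : SimpleGraph W)
    (σ : W → V) : Prop where
  injective : Function.Injective σ
  range_eq : Set.range σ = Si
  adj_iff : ∀ x y, G.Adj x y ↔ x ≠ y ∧ ∃ o, H.Adj (σ x) o ∧ H.Adj o (σ y)

variable {W : Type*} {G : SimpleGraph W} {σ : W → V}

theorem IsSkeleton.mem (hσ : IsSkeleton H Si G σ) (x : W) : σ x ∈ Si :=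
  hσ.range_eq ▸ ⟨x, rfl⟩

/-- After smoothing, the pendant vertices are precisely the unshared oxygen atoms, so what survives
their deletion is the set of silicon atoms. -/
theorem exists_isSkeleton [Finite V] (h : H.IsSiliconSet Si)
    (φ : H.smooth.deletePendants ≃g G) : ∃ σ : W → V, IsSkeleton H Si G σ := by
  have hinj : Function.Injective fun x => (φ.symm x).1.1 :=
    (Subtype.val_injective.comp Subtype.val_injective).comp φ.symm.injective
  have hmem : ∀ x, (φ.symm x).1.1 ∈ Si := by
    intro x
    by_contra hx
    exact (φ.symm x).2 (h.ncard_smooth_neighborSet_of_notMem _ hx)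
  refine ⟨fun x => (φ.symm x).1.1, hinj, ?_, ?_⟩
  · ext s
    constructor
    · rintro ⟨x, rfl⟩
      exact hmem x
    · intro hs
      refine ⟨φ ⟨⟨s, h.ncard_ne_two hs⟩, h.ncard_smooth_neighborSet_of_mem _ hs⟩, ?_⟩
      simp
  · intro x y
    rw [← φ.symm.map_adj_iff]
    change H.smooth.Adj (φ.symm x).1 (φ.symm y).1 ↔ _
    rw [h.smooth_adj_iff]
    constructor
    · rintro (a | ⟨hne, o, -, a, b⟩)
      · exact absurd (hmem y) (h.notMem_of_adj (hmem x) a)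
      · refine ⟨?_, o, a, b⟩
        rintro rfl
        exact hne rfl
    · rintro ⟨hne, o, a, b⟩
      refine .inr ⟨fun he => hne (hinj (congrArg Subtype.val he)), o, ?_, a, b⟩
      exact h.ncard_eq_two_of_adj (h.notMem_of_adj (hmem x) a) a.symm b (hinj.ne hne)

theorem IsSkeleton.ncard_leavesAt_add [Finite V] (h : H.IsSiliconSet Si)
    (hσ : IsSkeleton H Si G σ) (x : W) :
    (H.leavesAt (σ x)).ncard + (G.neighborSet x).ncard = 4 := by
  rw [← h.ncard_leavesAt_add (hσ.mem x), ← Set.ncard_image_of_injective _ hσ.injective]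
  congr 2
  ext t
  simp only [Set.mem_image, mem_neighborSet, Set.mem_ofPred_eq]
  constructor
  · rintro ⟨y, hy, rfl⟩
    obtain ⟨hne, ho⟩ := (hσ.adj_iff x y).1 hy
    exact ⟨hσ.mem y, hσ.injective.ne hne.symm, ho⟩
  · rintro ⟨ht, hne, ho⟩
    rw [← hσ.range_eq] at ht
    obtain ⟨y, rfl⟩ := ht
    exact ⟨y, (hσ.adj_iff x y).2 ⟨fun he => hne (he ▸ rfl), ho⟩, rfl⟩

/-- Smoothing a silicate gives back its skeleton with leaves attached. -/
theorem IsSkeleton.nonempty_iso_attachLeaves [Finite V] (h : H.IsSiliconSet Si)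
    (hσ : IsSkeleton H Si G σ) (M : G.Subgraph)
    (h3 : ∀ x ∈ M.verts, (G.neighborSet x).ncard = 3)
    (h2 : ∀ x ∉ M.verts, (G.neighborSet x).ncard = 2) :
    Nonempty (H.smooth ≃g G.attachLeaves M) := by
  -- Four minus the degree: one leaf at a covered vertex, two at any other, as in `attachLeaves`.
  have hcard : ∀ x, Nonempty ({i : Fin 2 // x ∈ M.verts → i = 0} ≃ H.leavesAt (σ x)) := by
    intro x
    refine Finite.card_eq.1 ?_
    rw [Nat.card_coe_set_eq]
    have h4 := hσ.ncard_leavesAt_add h x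
    by_cases hx : x ∈ M.verts
    · have := h3 x hx
      simp only [hx, forall_const, Nat.card_unique]
      omega
    · have := h2 x hx
      simp only [hx, false_imp_iff, Nat.card_eq_fintype_card, Fintype.card_subtype_true,
        Fintype.card_fin]
      omega
  have e : ∀ x, {i : Fin 2 // x ∈ M.verts → i = 0} ≃ H.leavesAt (σ x) := fun x => (hcard x).some
  have hleaf : ∀ x (l : H.leavesAt (σ x)), (H.neighborSet l.1).ncard = 1 := fun x l => l.2.2
  let f : W ⊕ {l : W × Fin 2 // l.1 ∈ M.verts → l.2 = 0} → {v : V // (H.neighborSet v).ncard ≠ 2} :=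
    Sum.elim (fun x => ⟨σ x, h.ncard_ne_two (hσ.mem x)⟩)
      fun l => ⟨(e l.1.1 ⟨l.1.2, l.2⟩).1, by rw [hleaf]; norm_num⟩
  have hunique : ∀ x y (l : H.leavesAt (σ x)), H.Adj (σ y) l.1 → x = y := fun x y l hl =>
    hσ.injective (eq_of_adj_of_ncard_neighborSet_eq_one l.2.2 l.2.1.symm hl.symm)
  have hinj : Function.Injective f := by
    rintro (x | ⟨⟨x, i⟩, hi⟩) (y | ⟨⟨y, j⟩, hj⟩) hxy
    · exact congrArg _ (hσ.injective (congrArg Subtype.val hxy))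
    · have h1 : σ x = (e y ⟨j, hj⟩).1 := congrArg Subtype.val hxy
      exact absurd (hσ.mem x) (h1 ▸ h.notMem_of_ncard_eq_one (hleaf _ _))
    · have h1 : (e x ⟨i, hi⟩).1 = σ y := congrArg Subtype.val hxy
      exact absurd (hσ.mem y) (h1 ▸ h.notMem_of_ncard_eq_one (hleaf _ _))
    · have h1 : (e x ⟨i, hi⟩).1 = (e y ⟨j, hj⟩).1 := congrArg Subtype.val hxy
      have h2 : x = y := hunique x y (e x ⟨i, hi⟩) (h1 ▸ (e y ⟨j, hj⟩).2.1)
      subst h2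
      have h3 := (e x).injective (Subtype.ext h1)
      simp only [Subtype.mk.injEq] at h3
      subst h3
      rfl
  have hsurj : Function.Surjective f := by
    rintro ⟨v, hv⟩
    by_cases hvSi : v ∈ Si
    · rw [← hσ.range_eq] at hvSi
      obtain ⟨x, rfl⟩ := hvSi
      exact ⟨.inl x, rfl⟩
    · obtain ⟨s, hs⟩ := h.exists_adj v
      have hsSi := h.mem_of_adj hvSi hs
      rw [← hσ.range_eq] at hsSi
      obtain ⟨x, rfl⟩ := hsSi
      obtain ⟨⟨i, hi⟩, hl⟩ := (e x).surjective ⟨v, hs.symm, h.ncard_eq_one hvSi hv⟩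
      refine ⟨.inr ⟨⟨x, i⟩, hi⟩, Subtype.ext ?_⟩
      change (e x ⟨i, hi⟩).1 = v
      rw [hl]
  have hmixed : ∀ x y (l : H.leavesAt (σ y)) (hl : (H.neighborSet l.1).ncard ≠ 2),
      H.smooth.Adj ⟨σ x, h.ncard_ne_two (hσ.mem x)⟩ ⟨l.1, hl⟩ ↔ y = x := by
    intro x y l hl
    rw [h.smooth_adj_iff]
    constructor
    · rintro (a | ⟨-, o, ho, a, b⟩)
      · exact hunique y x l a
      · exact absurd (h.mem_of_adj (h.notMem_of_ncard_eq_two ho) b)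
          (h.notMem_of_ncard_eq_one l.2.2)
    · rintro rfl
      exact .inl l.2.1
  refine ⟨RelIso.symm ⟨Equiv.ofBijective f ⟨hinj, hsurj⟩, ?_⟩⟩
  rintro (x | ⟨⟨x, i⟩, hi⟩) (y | ⟨⟨y, j⟩, hj⟩)
  · change H.smooth.Adj ⟨σ x, _⟩ ⟨σ y, _⟩ ↔ G.Adj x y
    rw [h.smooth_adj_iff, hσ.adj_iff]
    constructor
    · rintro (a | ⟨hne, o, -, a, b⟩)
      · exact absurd (hσ.mem y) (h.notMem_of_adj (hσ.mem x) a)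
      · refine ⟨?_, o, a, b⟩
        rintro rfl
        exact hne rfl
    · rintro ⟨hne, o, a, b⟩
      refine .inr ⟨fun he => hne (hσ.injective (congrArg Subtype.val he)), o, ?_, a, b⟩
      exact h.ncard_eq_two_of_adj (h.notMem_of_adj (hσ.mem x) a) a.symm b (hσ.injective.ne hne)
  · exact hmixed x y (e y ⟨j, hj⟩) _
  · change H.smooth.Adj ⟨(e x ⟨i, hi⟩).1, _⟩ ⟨σ y, _⟩ ↔ x = y
    rw [adj_comm]
    exact hmixed y x (e x ⟨i, hi⟩) _
  · change H.smooth.Adj ⟨(e x ⟨i, hi⟩).1, _⟩ ⟨(e y ⟨j, hj⟩).1, _⟩ ↔ False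
    rw [h.smooth_adj_iff, iff_false]
    have h1 := h.notMem_of_ncard_eq_one (hleaf x (e x ⟨i, hi⟩))
    have h2 := h.notMem_of_ncard_eq_one (hleaf y (e y ⟨j, hj⟩))
    rintro (a | ⟨-, o, ho, a, b⟩)
    · exact h2 (h.mem_of_adj h1 a)
    · exact h.notMem_of_ncard_eq_two ho (h.mem_of_adj h1 a)

end IsSiliconSet

end SimpleGraph

/-! ### Coordinates of the nanosheet -/

/-- A centre is recovered by lowering one coordinate when the sum is 1 and two when it is 2. A
coordinate equal to `r` must be lowered and one equal to `1 - r` must not; the sum leaves room for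
such a choice. -/
theorem exists_sheetCentre_iff {r : ℕ} (hr : 1 ≤ r) (v : Fin 3 → ℤ) :
    (∃ c, IsSheetCentre r c ∧ IsHexagonCorner c v) ↔
      (v 0 + v 1 + v 2 = 1 ∨ v 0 + v 1 + v 2 = 2) ∧ ∀ i, 1 - (r : ℤ) ≤ v i ∧ v i ≤ r := by
  constructor
  · rintro ⟨c, ⟨-, hc⟩, hv, hs⟩
    refine ⟨by simpa [Fin.sum_univ_three] using hs, fun i => ?_⟩
    have h1 := abs_lt.1 (hc i)
    have h2 := hv i
    omega
  · rintro ⟨hs, hb⟩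
    have h0 := hb 0
    have h1 := hb 1
    have h2 := hb 2
    have key : ∀ c : Fin 3 → ℤ, c 0 + c 1 + c 2 = 0 → (∀ i, v i - c i = 0 ∨ v i - c i = 1) →
        (∀ i, -(r : ℤ) < c i ∧ c i < r) → ∃ c, IsSheetCentre r c ∧ IsHexagonCorner c v := by
      intro c h3 h4 h5
      refine ⟨c, ⟨by simpa [Fin.sum_univ_three] using h3, fun i => abs_lt.2 (h5 i)⟩, h4, ?_⟩
      simpa [Fin.sum_univ_three] using hs
    rcases hs with hs | hs
    · have : (2 - (r : ℤ) ≤ v 0 ∧ v 1 < r ∧ v 2 < r) ∨ (2 - (r : ℤ) ≤ v 1 ∧ v 0 < r ∧ v 2 < r) ∨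
          (2 - (r : ℤ) ≤ v 2 ∧ v 0 < r ∧ v 1 < r) := by omega
      rcases this with h | h | h
      · apply key ![v 0 - 1, v 1, v 2] <;> simp [Fin.forall_fin_succ] <;> omega
      · apply key ![v 0, v 1 - 1, v 2] <;> simp [Fin.forall_fin_succ] <;> omega
      · apply key ![v 0, v 1, v 2 - 1] <;> simp [Fin.forall_fin_succ] <;> omega
    · have : (v 0 < (r : ℤ) ∧ 1 - r < v 1 ∧ 1 - r < v 2) ∨ (v 1 < r ∧ 1 - r < v 0 ∧ 1 - r < v 2) ∨
          (v 2 < (r : ℤ) ∧ 1 - r < v 0 ∧ 1 - r < v 1) := by omega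
      rcases this with h | h | h
      · apply key ![v 0, v 1 - 1, v 2 - 1] <;> simp [Fin.forall_fin_succ] <;> omega
      · apply key ![v 0 - 1, v 1, v 2 - 1] <;> simp [Fin.forall_fin_succ] <;> omega
      · apply key ![v 0 - 1, v 1 - 1, v 2] <;> simp [Fin.forall_fin_succ] <;> omega

namespace NanosheetVertex

variable {r : ℕ}

theorem sum_eq (u : NanosheetVertex r) :
    u.1 0 + u.1 1 + u.1 2 = 1 ∨ u.1 0 + u.1 1 + u.1 2 = 2 := by
  obtain ⟨c, -, -, h⟩ := u.2
  simpa [Fin.sum_univ_three] using h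

theorem bounds (hr : 1 ≤ r) (u : NanosheetVertex r) (i : Fin 3) :
    1 - (r : ℤ) ≤ u.1 i ∧ u.1 i ≤ r :=
  ((exists_sheetCentre_iff hr u.1).1 u.2).2 i

theorem exists_eq (hr : 1 ≤ r) (v : Fin 3 → ℤ)
    (hs : v 0 + v 1 + v 2 = 1 ∨ v 0 + v 1 + v 2 = 2)
    (hb : ∀ i, 1 - (r : ℤ) ≤ v i ∧ v i ≤ r) : ∃ u : NanosheetVertex r, u.1 = v :=
  ⟨⟨v, (exists_sheetCentre_iff hr v).2 ⟨hs, hb⟩⟩, rfl⟩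

/-- `v` is obtained from `u` by adding `1` to the coordinate `i`. -/
def Raise (i : Fin 3) (u v : NanosheetVertex r) : Prop :=
  ∀ j, v.1 j = u.1 j + if j = i then 1 else 0

theorem Raise.coords {i : Fin 3} {u v : NanosheetVertex r} (h : Raise i u v) :
    (i = 0 ∧ v.1 0 = u.1 0 + 1 ∧ v.1 1 = u.1 1 ∧ v.1 2 = u.1 2) ∨
    (i = 1 ∧ v.1 0 = u.1 0 ∧ v.1 1 = u.1 1 + 1 ∧ v.1 2 = u.1 2) ∨
    (i = 2 ∧ v.1 0 = u.1 0 ∧ v.1 1 = u.1 1 ∧ v.1 2 = u.1 2 + 1) := by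
  have h0 := h 0
  have h1 := h 1
  have h2 := h 2
  fin_cases i <;> simp_all

theorem Raise.sum_left {i : Fin 3} {u v : NanosheetVertex r} (h : Raise i u v) :
    u.1 0 + u.1 1 + u.1 2 = 1 := by
  have := u.sum_eq
  have := v.sum_eq
  rcases h.coords with h | h | h <;> omega

theorem Raise.sum_right {i : Fin 3} {u v : NanosheetVertex r} (h : Raise i u v) :
    v.1 0 + v.1 1 + v.1 2 = 2 := by
  have := h.sum_left
  rcases h.coords with h | h | h <;> omega

theorem Raise.apply_self {i : Fin 3} {u v : NanosheetVertex r} (h : Raise i u v) :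
    v.1 i = u.1 i + 1 := by
  simpa using h i

theorem Raise.right_unique {i : Fin 3} {u v w : NanosheetVertex r} (h : Raise i u v)
    (h' : Raise i u w) : v = w :=
  Subtype.ext (funext fun j => (h j).trans (h' j).symm)

theorem Raise.left_unique {i : Fin 3} {u v w : NanosheetVertex r} (h : Raise i u w)
    (h' : Raise i v w) : u = v :=
  Subtype.ext (funext fun j => by have := h j; have := h' j; omega)

theorem exists_raise (hr : 1 ≤ r) (u : NanosheetVertex r) (i : Fin 3)
    (hs : u.1 0 + u.1 1 + u.1 2 = 1) (hi : u.1 i < r) : ∃ v, Raise i u v := by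
  obtain ⟨v, hv⟩ := exists_eq hr (fun j => u.1 j + if j = i then 1 else 0)
    (by right; fin_cases i <;> simp <;> omega) (by
      intro j
      have := u.bounds hr j
      by_cases h : j = i
      · subst h
        simp
        omega
      · simp [h]
        omega)
  exact ⟨v, fun j => by rw [hv]⟩

theorem exists_raise_left (hr : 1 ≤ r) (v : NanosheetVertex r) (i : Fin 3)
    (hs : v.1 0 + v.1 1 + v.1 2 = 2) (hi : 1 - (r : ℤ) < v.1 i) : ∃ u, Raise i u v := by
  obtain ⟨u, hu⟩ := exists_eq hr (fun j => v.1 j - if j = i then 1 else 0)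
    (by left; fin_cases i <;> simp <;> omega) (by
      intro j
      have := v.bounds hr j
      by_cases h : j = i
      · subst h
        simp
        omega
      · simp [h]
        omega)
  exact ⟨u, fun j => by rw [hu]; simp⟩

/-- The two lattice hexagons on this edge have centres obtained from `u` by lowering a coordinate
other than `i`; at least one of them belongs to the sheet. -/
theorem Raise.adj (hr : 1 ≤ r) {i : Fin 3} {u v : NanosheetVertex r} (h : Raise i u v) :
    (nanosheet r).Adj u v := by
  have hs := h.sum_left
  have u0 := u.bounds hr 0
  have u1 := u.bounds hr 1
  have u2 := u.bounds hr 2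
  have v0 := v.bounds hr 0
  have v1 := v.bounds hr 1
  have v2 := v.bounds hr 2
  have key : ∀ c : Fin 3 → ℤ, c 0 + c 1 + c 2 = 0 →
      (∀ i, u.1 i - c i = 0 ∨ u.1 i - c i = 1) → (∀ i, v.1 i - c i = 0 ∨ v.1 i - c i = 1) →
        (∀ i, -(r : ℤ) < c i ∧ c i < r) → (nanosheet r).Adj u v := by
    intro c h3 h4 h5 h6
    refine ⟨?_, c, ⟨by simpa [Fin.sum_univ_three] using h3, fun i => abs_lt.2 (h6 i)⟩,
      ⟨h4, by simpa [Fin.sum_univ_three] using u.sum_eq⟩,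
      ⟨h5, by simpa [Fin.sum_univ_three] using v.sum_eq⟩⟩
    rcases h.coords with h | h | h <;> simp [Fin.sum_univ_three, h]
  rcases h.coords with ⟨-, h⟩ | ⟨-, h⟩ | ⟨-, h⟩
  · have : (2 - (r : ℤ) ≤ u.1 1 ∧ u.1 2 < r) ∨ (2 - (r : ℤ) ≤ u.1 2 ∧ u.1 1 < r) := by omega
    rcases this with h' | h'
    · apply key ![u.1 0, u.1 1 - 1, u.1 2] <;> simp [Fin.forall_fin_succ] <;> omega
    · apply key ![u.1 0, u.1 1, u.1 2 - 1] <;> simp [Fin.forall_fin_succ] <;> omega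
  · have : (2 - (r : ℤ) ≤ u.1 0 ∧ u.1 2 < r) ∨ (2 - (r : ℤ) ≤ u.1 2 ∧ u.1 0 < r) := by omega
    rcases this with h' | h'
    · apply key ![u.1 0 - 1, u.1 1, u.1 2] <;> simp [Fin.forall_fin_succ] <;> omega
    · apply key ![u.1 0, u.1 1, u.1 2 - 1] <;> simp [Fin.forall_fin_succ] <;> omega
  · have : (2 - (r : ℤ) ≤ u.1 0 ∧ u.1 1 < r) ∨ (2 - (r : ℤ) ≤ u.1 1 ∧ u.1 0 < r) := by omega
    rcases this with h' | h'
    · apply key ![u.1 0 - 1, u.1 1, u.1 2] <;> simp [Fin.forall_fin_succ] <;> omega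
    · apply key ![u.1 0, u.1 1 - 1, u.1 2] <;> simp [Fin.forall_fin_succ] <;> omega

theorem adj_iff (hr : 1 ≤ r) (u v : NanosheetVertex r) :
    (nanosheet r).Adj u v ↔ ∃ i, Raise i u v ∨ Raise i v u := by
  constructor
  · rintro ⟨h, -⟩
    rw [Fin.sum_univ_three] at h
    have key : ∀ a b c : ℤ, |a| + |b| + |c| = 1 →
        (b = 0 ∧ c = 0 ∧ (a = 1 ∨ a = -1)) ∨ (a = 0 ∧ c = 0 ∧ (b = 1 ∨ b = -1)) ∨
          (a = 0 ∧ b = 0 ∧ (c = 1 ∨ c = -1)) := by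
      intro a b c
      rcases abs_cases a with h1 | h1 <;> rcases abs_cases b with h2 | h2 <;>
        rcases abs_cases c with h3 | h3 <;> omega
    rcases key _ _ _ h with ⟨h1, h2, h3 | h3⟩ | ⟨h1, h2, h3 | h3⟩ | ⟨h1, h2, h3 | h3⟩
    · exact ⟨0, .inr fun j => by fin_cases j <;> simp <;> omega⟩
    · exact ⟨0, .inl fun j => by fin_cases j <;> simp <;> omega⟩
    · exact ⟨1, .inr fun j => by fin_cases j <;> simp <;> omega⟩
    · exact ⟨1, .inl fun j => by fin_cases j <;> simp <;> omega⟩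
    · exact ⟨2, .inr fun j => by fin_cases j <;> simp <;> omega⟩
    · exact ⟨2, .inl fun j => by fin_cases j <;> simp <;> omega⟩
  · rintro ⟨i, h | h⟩
    · exact h.adj hr
    · exact (h.adj hr).symm

theorem ncard_neighborSet_of_sum_eq_one (hr : 1 ≤ r) (u : NanosheetVertex r)
    (hs : u.1 0 + u.1 1 + u.1 2 = 1) :
    ((nanosheet r).neighborSet u).ncard = {i | u.1 i < r}.ncard := by
  symm
  have hex : ∀ i ∈ {i | u.1 i < r}, ∃ v, Raise i u v := fun i hi => u.exists_raise hr i hs hi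
  have : Nonempty (NanosheetVertex r) := ⟨u⟩
  choose! f hf using hex
  refine Set.ncard_congr (fun i _ => f i) (fun i hi => (hf i hi).adj hr) ?_ ?_
  · intro i j hi hj h
    have h1 := hf i hi i
    have h2 := hf j hj i
    rw [← h] at h2
    by_contra hne
    simp only [hne, if_true, if_false] at h1 h2
    omega
  · intro v hv
    obtain ⟨i, h | h⟩ := (adj_iff hr u v).1 hv
    · have hi : u.1 i < r := by
        have := h.apply_self
        have := v.bounds hr i
        omega
      exact ⟨i, hi, (hf i hi).right_unique h⟩
    · have := h.sum_right
      omega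

theorem ncard_neighborSet_of_sum_eq_two (hr : 1 ≤ r) (u : NanosheetVertex r)
    (hs : u.1 0 + u.1 1 + u.1 2 = 2) :
    ((nanosheet r).neighborSet u).ncard = {i | 1 - (r : ℤ) < u.1 i}.ncard := by
  symm
  have hex : ∀ i ∈ {i | 1 - (r : ℤ) < u.1 i}, ∃ v, Raise i v u :=
    fun i hi => u.exists_raise_left hr i hs hi
  have : Nonempty (NanosheetVertex r) := ⟨u⟩
  choose! f hf using hex
  refine Set.ncard_congr (fun i _ => f i) (fun i hi => ((hf i hi).adj hr).symm) ?_ ?_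
  · intro i j hi hj h
    have h1 := hf i hi i
    have h2 := hf j hj i
    rw [← h] at h2
    by_contra hne
    simp only [hne, if_true, if_false] at h1 h2
    omega
  · intro v hv
    obtain ⟨i, h | h⟩ := (adj_iff hr u v).1 hv
    · have := h.sum_left
      omega
    · have hi : 1 - (r : ℤ) < u.1 i := by
        have := h.apply_self
        have := v.bounds hr i
        omega
      exact ⟨i, hi, (hf i hi).left_unique h⟩

/-- `u` is an interior vertex of the nanosheet, that is, a vertex of degree three. -/
def IsInterior (u : NanosheetVertex r) : Prop :=
  (u.1 0 + u.1 1 + u.1 2 = 1 ∧ ∀ i, u.1 i < r) ∨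
    (u.1 0 + u.1 1 + u.1 2 = 2 ∧ ∀ i, 1 - (r : ℤ) < u.1 i)

theorem ncard_neighborSet_of_isInterior (hr : 1 ≤ r) {u : NanosheetVertex r} (hu : u.IsInterior) :
    ((nanosheet r).neighborSet u).ncard = 3 := by
  rcases hu with ⟨hs, hu⟩ | ⟨hs, hu⟩
  · rw [ncard_neighborSet_of_sum_eq_one hr u hs]
    simp [hu, Set.ncard_univ]
  · rw [ncard_neighborSet_of_sum_eq_two hr u hs]
    simp [hu, Set.ncard_univ]

/-- The bounds and the coordinate sum allow only one coordinate to be extremal, so only one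
direction is lost. -/
theorem ncard_neighborSet_of_not_isInterior (hr : 1 ≤ r) {u : NanosheetVertex r}
    (hu : ¬ u.IsInterior) : ((nanosheet r).neighborSet u).ncard = 2 := by
  have u0 := u.bounds hr 0
  have u1 := u.bounds hr 1
  have u2 := u.bounds hr 2
  have hcompl : ∀ k : Fin 3, ({k}ᶜ : Set (Fin 3)).ncard = 2 := fun k => by
    rw [Set.ncard_compl]
    simp
  rcases u.sum_eq with hs | hs
  · rw [ncard_neighborSet_of_sum_eq_one hr u hs]
    have : ∃ k, ¬ u.1 k < r := by
      by_contra! h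
      exact hu (.inl ⟨hs, h⟩)
    obtain ⟨k, hk⟩ := this
    rw [← hcompl k]
    congr 1
    ext i
    simp only [Set.mem_ofPred_eq, Set.mem_compl_iff, Set.mem_singleton_iff]
    fin_cases k <;> fin_cases i <;> simp at hk ⊢ <;> omega
  · rw [ncard_neighborSet_of_sum_eq_two hr u hs]
    have : ∃ k, ¬ 1 - (r : ℤ) < u.1 k := by
      by_contra! h
      exact hu (.inr ⟨hs, h⟩)
    obtain ⟨k, hk⟩ := this
    rw [← hcompl k]
    congr 1
    ext i
    simp only [Set.mem_ofPred_eq, Set.mem_compl_iff, Set.mem_singleton_iff]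
    fin_cases k <;> fin_cases i <;> simp at hk ⊢ <;> omega

/-! ### The distance from the central hexagon -/

/-- The distance of a vertex from the central hexagon, in coordinates. -/
def level (u : NanosheetVertex r) : ℕ :=
  ((u.1 0 - 1).toNat + (-u.1 0).toNat) + ((u.1 1 - 1).toNat + (-u.1 1).toNat) +
    ((u.1 2 - 1).toNat + (-u.1 2).toNat)

/-- Trades truncated subtraction for sign cases in which everything is linear. -/
theorem level_eq (u : NanosheetVertex r) : ∃ a b c : ℕ, u.level = a + b + c ∧
    (0 < u.1 0 ∧ (a : ℤ) = u.1 0 - 1 ∨ u.1 0 ≤ 0 ∧ (a : ℤ) = -u.1 0) ∧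
    (0 < u.1 1 ∧ (b : ℤ) = u.1 1 - 1 ∨ u.1 1 ≤ 0 ∧ (b : ℤ) = -u.1 1) ∧
    (0 < u.1 2 ∧ (c : ℤ) = u.1 2 - 1 ∨ u.1 2 ≤ 0 ∧ (c : ℤ) = -u.1 2) := by
  have key : ∀ x : ℤ, 0 < x ∧ (((x - 1).toNat + (-x).toNat : ℕ) : ℤ) = x - 1 ∨
      x ≤ 0 ∧ (((x - 1).toNat + (-x).toNat : ℕ) : ℤ) = -x := fun x => by omega
  exact ⟨_, _, _, rfl, key _, key _, key _⟩

theorem Raise.level_cases {i : Fin 3} {u v : NanosheetVertex r} (h : Raise i u v) :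
    (0 < u.1 i ∧ v.level = u.level + 1) ∨ (u.1 i = 0 ∧ v.level = u.level) ∨
      (u.1 i < 0 ∧ v.level + 1 = u.level) := by
  unfold level
  rcases h.coords with ⟨rfl, h0, h1, h2⟩ | ⟨rfl, h0, h1, h2⟩ | ⟨rfl, h0, h1, h2⟩ <;>
    rw [h0, h1, h2] <;> omega

theorem level_le_of_adj (hr : 1 ≤ r) {u v : NanosheetVertex r} (h : (nanosheet r).Adj u v) :
    u.level ≤ v.level + 1 := by
  obtain ⟨i, h | h⟩ := (adj_iff hr u v).1 h <;> rcases h.level_cases with h | h | h <;> omega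

theorem level_le_of_walk (hr : 1 ≤ r) {u v : NanosheetVertex r} (p : (nanosheet r).Walk u v) :
    u.level ≤ v.level + p.length := by
  induction p with
  | nil => simp
  | cons h p ih =>
    have := level_le_of_adj hr h
    rw [SimpleGraph.Walk.length_cons]
    omega

/-- Outside the central hexagon, a vertex of sum 1 has a negative coordinate that can be raised, and
one of sum 2 has a coordinate above 1 that can be lowered. -/
theorem exists_adj_level (hr : 1 ≤ r) {u : NanosheetVertex r} (h : u.level ≠ 0) :
    ∃ v, (nanosheet r).Adj u v ∧ v.level + 1 = u.level := by
  obtain ⟨a, b, c, habc, h0, h1, h2⟩ := u.level_eq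
  rcases u.sum_eq with hs | hs
  · have : ∃ i, u.1 i < 0 := by
      by_contra! hall
      have := hall 0
      have := hall 1
      have := hall 2
      omega
    obtain ⟨i, hi⟩ := this
    obtain ⟨v, hv⟩ := u.exists_raise hr i hs (by omega)
    refine ⟨v, hv.adj hr, ?_⟩
    have := hv.level_cases
    omega
  · have : ∃ i, 1 < u.1 i := by
      by_contra! hall
      have := hall 0
      have := hall 1
      have := hall 2
      omega
    obtain ⟨i, hi⟩ := this
    obtain ⟨v, hv⟩ := u.exists_raise_left hr i hs (by omega)
    refine ⟨v, (hv.adj hr).symm, ?_⟩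
    have := hv.level_cases
    have := hv.apply_self
    omega

theorem mem_centralHexagon_iff (u : NanosheetVertex r) :
    u ∈ centralHexagon r ↔ ∀ i, 0 ≤ u.1 i ∧ u.1 i ≤ 1 := by
  have hs := u.sum_eq
  simp only [centralHexagon, IsHexagonCorner, Set.mem_ofPred_eq, Fin.sum_univ_three,
    Pi.zero_apply, sub_zero]
  exact ⟨fun h i => by have := h.1 i; omega, fun h => ⟨fun i => by have := h i; omega, hs⟩⟩

theorem level_eq_zero_iff (u : NanosheetVertex r) : u.level = 0 ↔ u ∈ centralHexagon r := by
  rw [mem_centralHexagon_iff]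
  obtain ⟨a, b, c, habc, h0, h1, h2⟩ := u.level_eq
  constructor
  · intro h i
    fin_cases i <;> simp <;> omega
  · intro h
    have := h 0
    have := h 1
    have := h 2
    omega

theorem reachable_of_mem_centralHexagon (hr : 1 ≤ r) {u v : NanosheetVertex r}
    (hu : u ∈ centralHexagon r) (hv : v ∈ centralHexagon r) : (nanosheet r).Reachable u v := by
  have key : ∀ u ∈ centralHexagon r, ∀ v ∈ centralHexagon r,
      u.1 0 + u.1 1 + u.1 2 = 1 → v.1 0 + v.1 1 + v.1 2 = 1 → (nanosheet r).Reachable u v := by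
    intro u hu v hv hsu hsv
    by_cases heq : u = v
    · exact heq ▸ SimpleGraph.Reachable.refl u
    rw [mem_centralHexagon_iff] at hu hv
    have u0 := hu 0
    have u1 := hu 1
    have u2 := hu 2
    have v0 := hv 0
    have v1 := hv 1
    have v2 := hv 2
    have hlt : ∀ x y : NanosheetVertex r, x.1 0 + x.1 1 + x.1 2 = 1 →
        y.1 0 + y.1 1 + y.1 2 = 1 → x ≠ y → ∃ i, x.1 i < y.1 i := by
      intro x y hx hy hxy
      by_contra! h
      refine hxy (Subtype.ext (funext fun i => ?_))
      have h0 := h 0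
      have h1 := h 1
      have h2 := h 2
      fin_cases i <;> simp <;> omega
    obtain ⟨i, hi⟩ := hlt u v hsu hsv heq
    obtain ⟨j, hj⟩ := hlt v u hsv hsu (Ne.symm heq)
    obtain ⟨w, hw⟩ := u.exists_raise hr i hsu (by have := v.bounds hr i; omega)
    obtain ⟨w', hw'⟩ := v.exists_raise hr j hsv (by have := u.bounds hr j; omega)
    have : w = w' := by
      refine Subtype.ext (funext fun k => ?_)
      rw [hw k, hw' k]
      fin_cases i <;> fin_cases j <;> simp at hi hj <;> fin_cases k <;> simp <;> omega
    subst this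
    exact (hw.adj hr).reachable.trans (hw'.adj hr).reachable.symm
  have lower : ∀ u ∈ centralHexagon r, ∃ v ∈ centralHexagon r, v.1 0 + v.1 1 + v.1 2 = 1 ∧
      (nanosheet r).Reachable u v := by
    intro u hu
    rcases u.sum_eq with hs | hs
    · exact ⟨u, hu, hs, SimpleGraph.Reachable.refl u⟩
    · rw [mem_centralHexagon_iff] at hu
      have : ∃ i, 0 < u.1 i := by
        by_contra! hall
        have := hall 0
        have := hall 1
        have := hall 2
        omega
      obtain ⟨i, hi⟩ := this
      obtain ⟨v, hv⟩ := u.exists_raise_left hr i hs (by omega)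
      refine ⟨v, ?_, hv.sum_left, (hv.adj hr).reachable.symm⟩
      rw [mem_centralHexagon_iff]
      intro j
      have h1 := hv j
      have h2 := hu j
      by_cases hji : j = i
      · subst hji
        simp only [if_true] at h1
        omega
      · simp only [hji, if_false] at h1
        omega
  obtain ⟨u', hu', hsu, hru⟩ := lower u hu
  obtain ⟨v', hv', hsv, hrv⟩ := lower v hv
  exact hru.trans ((key u' hu' v' hv' hsu hsv).trans hrv.symm)

theorem exists_walk_length_eq_level (hr : 1 ≤ r) (n : ℕ) : ∀ u : NanosheetVertex r, u.level = n →
    ∃ c ∈ centralHexagon r, ∃ p : (nanosheet r).Walk u c, p.length = n := by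
  induction n with
  | zero => exact fun u hu => ⟨u, (level_eq_zero_iff u).1 hu, SimpleGraph.Walk.nil, rfl⟩
  | succ n ih =>
    intro u hu
    obtain ⟨v, hv, hl⟩ := exists_adj_level hr (u := u) (by omega)
    obtain ⟨c, hc, p, hp⟩ := ih v (by omega)
    exact ⟨c, hc, SimpleGraph.Walk.cons hv p, by simp [hp]⟩

theorem distToSet_eq_level (hr : 1 ≤ r) (u : NanosheetVertex r) :
    (nanosheet r).distToSet u (centralHexagon r) = u.level := by
  obtain ⟨c, hc, p, hp⟩ := exists_walk_length_eq_level hr _ u rfl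
  -- Level drops by at most one per step. Reachability of every `c'` is needed because `dist` is 0
  -- between different components.
  have lower : ∀ c' ∈ centralHexagon r, u.level ≤ (nanosheet r).dist u c' := by
    intro c' hc'
    obtain ⟨q, hq⟩ :=
      (p.reachable.trans (reachable_of_mem_centralHexagon hr hc hc')).exists_walk_length_eq_dist
    have h1 := level_le_of_walk hr q
    rw [(level_eq_zero_iff c').2 hc'] at h1
    omega
  refine IsLeast.csInf_eq ⟨⟨c, hc, ?_⟩, ?_⟩
  · exact le_antisymm (hp ▸ SimpleGraph.dist_le p) (lower c hc)
  · rintro _ ⟨c', hc', rfl⟩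
    exact lower c' hc'

theorem isLayerStep_iff (hr : 1 ≤ r) (u v : NanosheetVertex r) :
    IsLayerStep r u v ↔ Even u.level ∧ v.level = u.level + 1 := by
  simp only [IsLayerStep, distToSet_eq_level hr]
  constructor
  · rintro ⟨k, -, h1, h2⟩
    exact ⟨⟨k, by omega⟩, by omega⟩
  · rintro ⟨⟨k, hk⟩, h⟩
    -- The range of `k` is no restriction: levels in the sheet are at most `2 * r - 2`.
    refine ⟨k, ?_, by omega, by omega⟩
    have := u.sum_eq
    have h0 := u.bounds hr 0
    have h1 := u.bounds hr 1
    have h2 := u.bounds hr 2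
    obtain ⟨a, b, c, habc, h3, h4, h5⟩ := u.level_eq
    omega

/-- An edge preserves the level only by raising a coordinate from 0 to 1. The two other coordinates
then sum to 1, so they are m + 1 and -m up to order with m ≥ 0, and the level is 2m. -/
theorem even_or_even_of_adj (hr : 1 ≤ r) {u v : NanosheetVertex r} (h : (nanosheet r).Adj u v) :
    Even u.level ∨ Even v.level := by
  have key : ∀ i u v, Raise (r := r) i u v → Even u.level ∨ Even v.level := by
    intro i u v h
    have hs := h.sum_left
    rw [Nat.even_iff, Nat.even_iff]
    obtain ⟨a, b, c, habc, h0, h1, h2⟩ := u.level_eq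
    rcases h.level_cases with h' | h' | h'
    · omega
    · rcases h.coords with ⟨rfl, -⟩ | ⟨rfl, -⟩ | ⟨rfl, -⟩ <;> omega
    · omega
  obtain ⟨i, h | h⟩ := (adj_iff hr u v).1 h
  · exact key i u v h
  · exact (key i v u h).symm

theorem layeredMatching_adj_iff (hr : 1 ≤ r) (u v : NanosheetVertex r) :
    (layeredMatching r).Adj u v ↔ (nanosheet r).Adj u v ∧
      (Even u.level ∧ v.level = u.level + 1 ∨ Even v.level ∧ u.level = v.level + 1) := by
  simp only [layeredMatching, isLayerStep_iff hr]

/-- The edges of the layered matching in coordinates: the coordinate that changes is the one whose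
sign differs from the signs of the two others. -/
theorem layeredMatching_adj_iff_of_raise (hr : 1 ≤ r) {i : Fin 3} {u v : NanosheetVertex r}
    (h : Raise i u v) : (layeredMatching r).Adj u v ↔
      ∀ j, j ≠ i → (0 < u.1 j ↔ u.1 i ≤ 0) := by
  rw [layeredMatching_adj_iff hr, and_iff_right (h.adj hr)]
  have hs := h.sum_left
  rw [Nat.even_iff, Nat.even_iff]
  obtain ⟨a, b, c, habc, h0, h1, h2⟩ := u.level_eq
  have h' := h.level_cases
  simp only [Fin.forall_fin_succ]
  rcases h0 with h0 | h0 <;> rcases h1 with h1 | h1 <;> rcases h2 with h2 | h2 <;>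
  rcases h.coords with ⟨rfl, -⟩ | ⟨rfl, -⟩ | ⟨rfl, -⟩ <;> simp <;> omega

end NanosheetVertex

namespace NanosheetVertex

variable {r : ℕ}

/-! ### The layered matching -/

theorem _root_.Fin.exists_third {i j : Fin 3} (hij : i ≠ j) : ∃ k : Fin 3, k ≠ i ∧ k ≠ j ∧
    ∀ x : Fin 3 → ℤ, x i + x j + x k = x 0 + x 1 + x 2 := by
  obtain ⟨k, hki, hkj⟩ : ∃ k : Fin 3, k ≠ i ∧ k ≠ j := by
    clear hij
    revert i j
    decide
  refine ⟨k, hki, hkj, fun x => ?_⟩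
  fin_cases i <;> fin_cases j <;> fin_cases k <;> simp at hij hki hkj <;> simp <;> ring

/-- At most one coordinate can have a sign opposite to both others. At a vertex of sum 2 the sign
test is made at the lower end of each edge, so there the coordinate sum is needed as well. -/
theorem layeredMatching_right_unique (hr : 1 ≤ r) {v w w' : NanosheetVertex r}
    (h : (layeredMatching r).Adj v w) (h' : (layeredMatching r).Adj v w') : w = w' := by
  obtain ⟨i, hi | hi⟩ := (adj_iff hr v w).1 h.1 <;> obtain ⟨j, hj | hj⟩ := (adj_iff hr v w').1 h'.1
  · rw [layeredMatching_adj_iff_of_raise hr hi] at h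
    rw [layeredMatching_adj_iff_of_raise hr hj] at h'
    have hij : i = j := by
      by_contra hne
      have h1 := h j (Ne.symm hne)
      obtain ⟨k, hki, hkj, hsum⟩ := Fin.exists_third hne
      have h2 := h k hki
      have h3 := h' k hkj
      omega
    subst hij
    exact hi.right_unique hj
  · have := hi.sum_left
    have := hj.sum_right
    omega
  · have := hi.sum_right
    have := hj.sum_left
    omega
  · have h1 := (layeredMatching_adj_iff_of_raise hr hi).1 h.symm
    have h2 := (layeredMatching_adj_iff_of_raise hr hj).1 h'.symm
    have hij : i = j := by
      by_contra hne
      obtain ⟨k, hki, hkj, hsum⟩ := Fin.exists_third hne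
      have h3 := h1 j (Ne.symm hne)
      have h4 := h1 k hki
      have h5 := h2 i hne
      have h6 := h2 k hkj
      have h7 := hi.apply_self
      have h8 := hi j
      have h9 := hi k
      have h10 := hj i
      have h11 := hj.apply_self
      have h12 := hj k
      have h13 := hsum v.1
      have h14 := hi.sum_right
      simp only [hne, Ne.symm hne, hki, hkj, if_false] at h8 h9 h10 h12
      omega
    subst hij
    exact hi.left_unique hj

theorem layeredMatching_isMatching (hr : 1 ≤ r) : (layeredMatching r).IsMatching := by
  rintro v ⟨w, hw⟩
  exact ⟨w, hw, fun w' hw' => layeredMatching_right_unique hr hw' hw⟩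

theorem exists_layeredMatching_adj (hr : 1 ≤ r) {v : NanosheetVertex r} (hv : v.IsInterior) :
    ∃ w, (layeredMatching r).Adj v w := by
  rcases hv with ⟨hs, hb⟩ | ⟨hs, hb⟩
  -- Sum 1 rules out three positive and three nonpositive coordinates, so one sign stands alone.
  · have : ∃ i, ∀ j, j ≠ i → (0 < v.1 j ↔ v.1 i ≤ 0) := by
      simp only [Fin.exists_fin_succ, Fin.forall_fin_succ]
      simp
      omega
    obtain ⟨i, hi⟩ := this
    obtain ⟨w, hw⟩ := v.exists_raise hr i hs (hb i)
    exact ⟨w, (layeredMatching_adj_iff_of_raise hr hw).2 hi⟩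
  -- The threshold is 1 because the sign is tested at the other end, where coordinate `i` is smaller
  -- by one.
  · have : ∃ i, ∀ j, j ≠ i → (0 < v.1 j ↔ v.1 i ≤ 1) := by
      simp only [Fin.exists_fin_succ, Fin.forall_fin_succ]
      simp
      omega
    obtain ⟨i, hi⟩ := this
    obtain ⟨w, hw⟩ := v.exists_raise_left hr i hs (hb i)
    refine ⟨w, ((layeredMatching_adj_iff_of_raise hr hw).2 fun j hj => ?_).symm⟩
    have h1 := hw j
    have h2 := hw.apply_self
    have h3 := hi j hj
    simp only [hj, if_false] at h1
    omega

/-- Direction `i` is free because `w` lies in the sheet. If another coordinate were extremal, the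
sign pattern and the sum would push coordinate `i` out of range. -/
theorem isInterior_of_layeredMatching_adj (hr : 1 ≤ r) {v w : NanosheetVertex r}
    (h : (layeredMatching r).Adj v w) : v.IsInterior := by
  have v0 := v.bounds hr 0
  have v1 := v.bounds hr 1
  have v2 := v.bounds hr 2
  have w0 := w.bounds hr 0
  have w1 := w.bounds hr 1
  have w2 := w.bounds hr 2
  obtain ⟨i, hi | hi⟩ := (adj_iff hr v w).1 h.1
  · refine .inl ⟨hi.sum_left, ?_⟩
    have hs := hi.sum_left
    rw [layeredMatching_adj_iff_of_raise hr hi] at h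
    simp only [Fin.forall_fin_succ] at h ⊢
    rcases hi.coords with ⟨rfl, hc⟩ | ⟨rfl, hc⟩ | ⟨rfl, hc⟩ <;> simp at h ⊢ <;> omega
  · refine .inr ⟨hi.sum_right, ?_⟩
    have hs := hi.sum_left
    have h' := (layeredMatching_adj_iff_of_raise hr hi).1 h.symm
    simp only [Fin.forall_fin_succ] at h' ⊢
    rcases hi.coords with ⟨rfl, hc⟩ | ⟨rfl, hc⟩ | ⟨rfl, hc⟩ <;> simp at h' ⊢ <;> omega

theorem mem_layeredMatching_verts_iff (hr : 1 ≤ r) (v : NanosheetVertex r) :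
    v ∈ (layeredMatching r).verts ↔ v.IsInterior :=
  ⟨fun ⟨_, h⟩ => isInterior_of_layeredMatching_adj hr h, exists_layeredMatching_adj hr⟩

/-- At a vertex of degree two, one coordinate is `r` (sum 1) or `1 - r` (sum 2); the bounds then put
the other two on the opposite side, and the level is exactly `2 * (r - 1)`. -/
theorem isInterior_of_not_even (hr : 1 ≤ r) {v : NanosheetVertex r} (h : ¬ Even v.level) :
    v.IsInterior := by
  have v0 := v.bounds hr 0
  have v1 := v.bounds hr 1
  have v2 := v.bounds hr 2
  rw [Nat.even_iff] at h
  obtain ⟨a, b, c, habc, h0, h1, h2⟩ := v.level_eq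
  rcases v.sum_eq with hs | hs
  · refine .inl ⟨hs, fun i => ?_⟩
    fin_cases i <;> simp <;> omega
  · refine .inr ⟨hs, fun i => ?_⟩
    fin_cases i <;> simp <;> omega

theorem not_even_iff_of_layeredMatching_adj (hr : 1 ≤ r) {v w : NanosheetVertex r}
    (h : (layeredMatching r).Adj v w) : ¬ Even v.level ↔ Even w.level := by
  have := ((layeredMatching_adj_iff hr v w).1 h).2
  rw [Nat.even_iff, Nat.even_iff] at *
  omega

/-! ### Counting -/

/-- The index set of the vertices of one parity in one of the six sectors. -/
abbrev Triangle (n : ℕ) : Type := {p : ℕ × ℕ // p.1 + p.2 < n}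

theorem _root_.finite_triangle (n : ℕ) : Finite (Triangle n) := by
  refine Set.Finite.subset (s := Set.Iio n ×ˢ Set.Iio n) (Set.toFinite _) ?_
  rintro ⟨a, b⟩ h
  have h : a + b < n := h
  simp only [Set.mem_prod, Set.mem_Iio]
  omega

theorem two_mul_card_triangle (n : ℕ) : 2 * Nat.card (Triangle n) = n * (n + 1) := by
  have h : {p : ℕ × ℕ | p.1 + p.2 < n} =
      ((Finset.range n).biUnion Finset.HasAntidiagonal.antidiagonal : Finset (ℕ × ℕ)) := by
    ext p
    simp
  have h1 : Nat.card (Triangle n) = ∑ k ∈ Finset.range n, (k + 1) := by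
    change Nat.card {p : ℕ × ℕ | p.1 + p.2 < n} = _
    rw [Nat.card_coe_set_eq, h, Set.ncard_coe_finset, Finset.card_biUnion]
    · simp
    · intro a _ b _ hab
      exact Finset.disjoint_left.2 fun p hp hp' => hab (by simp at hp hp'; omega)
  rw [h1]
  clear h h1
  induction n with
  | zero => simp
  | succ n ih =>
    rw [Finset.sum_range_succ, mul_add, ih]
    ring

/-- The coordinates of the vertices: in the sector of index `(i, b)`, the coordinate `i` is the one
whose sign differs from the signs of the others. -/
def coord (t : ℕ) (i : Fin 3) (b : Bool) (p : ℕ × ℕ) : Fin 3 → ℤ := fun j =>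
  if b then (if j = i then (t + p.1 + p.2 : ℤ) else if j = i + 1 then -p.1 else -p.2)
  else if j = i then 1 - (t + p.1 + p.2 : ℤ) else if j = i + 1 then 1 + p.1 else 1 + p.2

theorem coord_zero (t : ℕ) (b : Bool) (p : ℕ × ℕ) : coord t 0 b p =
    if b then ![(t + p.1 + p.2 : ℤ), -p.1, -p.2] else
      ![1 - (t + p.1 + p.2 : ℤ), 1 + p.1, 1 + p.2] := by
  funext j
  cases b <;> fin_cases j <;> simp [coord]

theorem coord_one (t : ℕ) (b : Bool) (p : ℕ × ℕ) : coord t 1 b p =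
    if b then ![-(p.2 : ℤ), (t + p.1 + p.2 : ℤ), -p.1] else
      ![1 + (p.2 : ℤ), 1 - (t + p.1 + p.2 : ℤ), 1 + p.1] := by
  funext j
  cases b <;> fin_cases j <;> simp [coord]

theorem coord_two (t : ℕ) (b : Bool) (p : ℕ × ℕ) : coord t 2 b p =
    if b then ![-(p.1 : ℤ), -p.2, (t + p.1 + p.2 : ℤ)] else
      ![1 + (p.1 : ℤ), 1 + p.2, 1 - (t + p.1 + p.2 : ℤ)] := by
  funext j
  cases b <;> fin_cases j <;> simp [coord]

theorem coord_injective (t : ℕ) (ht : 1 ≤ t) :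
    Function.Injective fun x : Fin 3 × Bool × (ℕ × ℕ) => coord t x.1 x.2.1 x.2.2 := by
  rintro ⟨i, b, a, c⟩ ⟨i', b', a', c'⟩ h
  have h0 := congrFun h 0
  have h1 := congrFun h 1
  have h2 := congrFun h 2
  clear h
  simp only at h0 h1 h2
  fin_cases i <;> fin_cases i' <;> cases b <;> cases b' <;>
    simp [coord_zero, coord_one, coord_two] at h0 h1 h2 ⊢ <;> omega

/-- A vertex with parameters `t` and `p` has level 2(p.1 + p.2) + t - 1, so `t` selects the parity;
its coordinate sum is `t` if `b` holds and 3 - t otherwise. The size of the triangle expresses that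
the lone coordinate stays in range. -/
theorem exists_coord (hr : 1 ≤ r) {t : ℕ} (ht : t = 1 ∨ t = 2) (v : NanosheetVertex r)
    (hv : v.level % 2 = t - 1) :
    ∃ i b, ∃ p : ℕ × ℕ, p.1 + p.2 < r + 1 - t ∧ coord t i b p = v.1 := by
  have v0 := v.bounds hr 0
  have v1 := v.bounds hr 1
  have v2 := v.bounds hr 2
  have hs := v.sum_eq
  obtain ⟨a, b, c, habc, h0, h1, h2⟩ := v.level_eq
  have key : ∀ w : Fin 3 → ℤ, w 0 = v.1 0 → w 1 = v.1 1 → w 2 = v.1 2 → w = v.1 := by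
    intro w h0 h1 h2
    funext j
    fin_cases j <;> assumption
  -- Of the eight sign patterns the two constant ones contradict the coordinate sum; the other six
  -- are the sectors.
  rcases h0 with h0 | h0 <;> rcases h1 with h1 | h1 <;> rcases h2 with h2 | h2
  · omega
  · refine ⟨2, false, (a, b), by simp only; omega, ?_⟩
    apply key <;> simp [coord_two] <;> omega
  · refine ⟨1, false, (c, a), by simp only; omega, ?_⟩
    apply key <;> simp [coord_one] <;> omega
  · refine ⟨0, true, (b, c), by simp only; omega, ?_⟩
    apply key <;> simp [coord_zero] <;> omega
  · refine ⟨0, false, (b, c), by simp only; omega, ?_⟩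
    apply key <;> simp [coord_zero] <;> omega
  · refine ⟨1, true, (c, a), by simp only; omega, ?_⟩
    apply key <;> simp [coord_one] <;> omega
  · refine ⟨2, true, (a, b), by simp only; omega, ?_⟩
    apply key <;> simp [coord_two] <;> omega
  · omega

theorem exists_eq_coord (hr : 1 ≤ r) {t : ℕ} (ht : t = 1 ∨ t = 2) (i : Fin 3) (b : Bool)
    (p : ℕ × ℕ) (hp : p.1 + p.2 < r + 1 - t) :
    ∃ v : NanosheetVertex r, v.1 = coord t i b p ∧ v.level % 2 = t - 1 := by
  obtain ⟨v, hv⟩ := exists_eq hr (coord t i b p)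
    (by fin_cases i <;> cases b <;> simp [coord_zero, coord_one, coord_two] <;> omega)
    (by
      intro j
      fin_cases i <;> cases b <;> fin_cases j <;> simp [coord_zero, coord_one, coord_two] <;> omega)
  refine ⟨v, hv, ?_⟩
  obtain ⟨a, b', c, habc, h0, h1, h2⟩ := v.level_eq
  rw [hv] at h0 h1 h2
  fin_cases i <;> cases b <;> simp [coord_zero, coord_one, coord_two] at h0 h1 h2 <;> omega

theorem nonempty_equiv_level (hr : 1 ≤ r) {t : ℕ} (ht : t = 1 ∨ t = 2) :
    Nonempty (Fin 3 × Bool × Triangle (r + 1 - t) ≃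
      {v : NanosheetVertex r // v.level % 2 = t - 1}) := by
  choose f hf hf' using fun x : Fin 3 × Bool × Triangle (r + 1 - t) =>
    exists_eq_coord hr ht x.1 x.2.1 x.2.2.1 x.2.2.2
  refine ⟨Equiv.ofBijective (fun x => ⟨f x, hf' x⟩) ⟨?_, ?_⟩⟩
  · intro x y hxy
    have h1 : f x = f y := congrArg Subtype.val hxy
    have h2 : coord t x.1 x.2.1 x.2.2.1 = coord t y.1 y.2.1 y.2.2.1 := by
      rw [← hf, ← hf, h1]
    have h3 := @coord_injective t (by omega) (x.1, x.2.1, x.2.2.1) (y.1, y.2.1, y.2.2.1) h2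
    simp only [Prod.mk.injEq] at h3
    exact Prod.ext h3.1 (Prod.ext h3.2.1 (Subtype.ext h3.2.2))
  · rintro ⟨v, hv⟩
    obtain ⟨i, b, p, hp, h⟩ := exists_coord hr ht v hv
    refine ⟨(i, b, ⟨p, hp⟩), Subtype.ext (Subtype.ext ?_)⟩
    rw [hf, ← h]

theorem card_level (hr : 1 ≤ r) {t : ℕ} (ht : t = 1 ∨ t = 2) :
    Nat.card {v : NanosheetVertex r // v.level % 2 = t - 1} =
      3 * ((r + 1 - t) * (r + 1 - t + 1)) := by
  obtain ⟨e⟩ := nonempty_equiv_level hr ht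
  rw [← Nat.card_congr e, Nat.card_prod, Nat.card_prod, ← two_mul_card_triangle]
  simp

theorem _root_.finite_nanosheetVertex (hr : 1 ≤ r) : Finite (NanosheetVertex r) := by
  have h1 : Finite {v : NanosheetVertex r // v.level % 2 = 0} := by
    obtain ⟨e⟩ := nonempty_equiv_level hr (.inl rfl)
    have := finite_triangle (r + 1 - 1)
    exact Finite.of_equiv _ e
  have h2 : Finite {v : NanosheetVertex r // v.level % 2 = 1} := by
    obtain ⟨e⟩ := nonempty_equiv_level hr (.inr rfl)
    have := finite_triangle (r + 1 - 2)
    exact Finite.of_equiv _ e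
  have h3 : {v : NanosheetVertex r | v.level % 2 = 0} ∪ {v | v.level % 2 = 1} = Set.univ := by
    ext v
    simp only [Set.mem_union, Set.mem_ofPred_eq, Set.mem_univ, iff_true]
    omega
  exact Set.finite_univ_iff.1 (h3 ▸ Set.Finite.union h1 h2)

theorem ncard_even (hr : 1 ≤ r) : {v : NanosheetVertex r | Even v.level}.ncard = 3 * (r ^ 2 + r) := by
  rw [← Nat.card_coe_set_eq]
  simp only [Nat.even_iff]
  refine (card_level hr (.inl rfl)).trans ?_
  simp only [Nat.add_sub_cancel]
  ring

theorem ncard_not_even (hr : 1 ≤ r) :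
    {v : NanosheetVertex r | ¬ Even v.level}.ncard = 3 * ((r - 1) * r) := by
  rw [← Nat.card_coe_set_eq]
  simp only [Nat.not_even_iff]
  refine (card_level hr (.inr rfl)).trans ?_
  obtain ⟨n, rfl⟩ := Nat.exists_eq_add_of_le' hr
  simp

theorem card_eq (hr : 1 ≤ r) : Nat.card (NanosheetVertex r) = 6 * r ^ 2 := by
  have := finite_nanosheetVertex hr
  have h := Set.ncard_add_ncard_compl {v : NanosheetVertex r | Even v.level}
  have h1 : {v : NanosheetVertex r | Even v.level}ᶜ = {v | ¬ Even v.level} := rfl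
  rw [h1, ncard_even hr, ncard_not_even hr] at h
  rw [← h]
  obtain ⟨n, rfl⟩ := Nat.exists_eq_add_of_le' hr
  simp only [Nat.add_sub_cancel]
  ring

/-- Each matching edge has exactly one end of odd level, and every vertex of odd level is covered,
being interior. -/
theorem ncard_layeredMatching_edgeSet (hr : 1 ≤ r) :
    (layeredMatching r).edgeSet.ncard = 3 * ((r - 1) * r) := by
  rw [← ncard_not_even hr]
  symm
  choose f hf using fun (v : NanosheetVertex r) (hv : ¬ Even v.level) =>
    exists_layeredMatching_adj hr (isInterior_of_not_even hr hv)
  refine Set.ncard_congr (fun v hv => s(v, f v hv)) (fun v hv => hf v hv) ?_ ?_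
  · intro v w hv hw h
    rcases Sym2.eq_iff.1 h with h | h
    · exact h.1
    · have := (not_even_iff_of_layeredMatching_adj hr (hf w hw)).1 hw
      exact absurd (h.1 ▸ this) hv
  · intro e he
    induction e with | _ v w
    have he : (layeredMatching r).Adj v w := he
    by_cases hv : Even v.level
    · have hw : ¬ Even w.level := (not_even_iff_of_layeredMatching_adj hr he.symm).2 hv
      refine ⟨w, hw, ?_⟩
      rw [layeredMatching_right_unique hr (hf w hw) he.symm, Sym2.eq_swap]
    · exact ⟨v, hv, by rw [layeredMatching_right_unique hr (hf v hv) he]⟩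

end NanosheetVertex

/-! ### The hexagonal silicate sheet -/

open NanosheetVertex in
theorem IsHexagonalSilicateSheet.gpack_eq_and_gt_eq {V : Type*} [Finite V] {r : ℕ} (hr : 1 ≤ r)
    {H : SimpleGraph V} {Si : Set V} (h : H.IsSiliconSet Si) {σ : NanosheetVertex r → V}
    (hσ : SimpleGraph.IsSiliconSet.IsSkeleton H Si (nanosheet r) σ) :
    H.gpack = 3 * (r ^ 2 + r) ∧ H.gt = 3 * (r ^ 2 + r) := by
  rw [← ncard_even hr, ← Set.ncard_image_of_injective _ hσ.injective]
  have hnt : ∀ x, (H.leavesAt (σ x)).Nontrivial ↔ ¬ x.IsInterior := by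
    intro x
    have hx := hσ.ncard_leavesAt_add h x
    rw [← Set.one_lt_ncard_iff_nontrivial]
    by_cases hi : x.IsInterior
    · have := ncard_neighborSet_of_isInterior hr hi
      simp only [hi, not_true_eq_false, iff_false]
      omega
    · have := ncard_neighborSet_of_not_isInterior hr hi
      simp only [hi, not_false_eq_true, iff_true]
      omega
  have hSi : ∀ s ∈ Si, ∃ x, σ x = s := fun s hs => by
    rw [← hσ.range_eq] at hs
    exact hs
  -- The cover is the image of the even levels under `σ`, and the partner relation is the layered
  -- matching carried over by `σ`.
  refine h.gpack_eq_and_gt_eq ?_ ?_ ?_ ?_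
    (fun s t => ∃ x y, σ x = s ∧ σ y = t ∧ (layeredMatching r).Adj x y) ?_ ?_
  · rintro _ ⟨x, -, rfl⟩
    exact hσ.mem x
  · intro s hs t ht o hst h1 h2
    obtain ⟨x, rfl⟩ := hSi s hs
    obtain ⟨y, rfl⟩ := hSi t ht
    have hadj := (hσ.adj_iff x y).2 ⟨fun he => hst (he ▸ rfl), o, h1, h2⟩
    exact (even_or_even_of_adj hr hadj).imp (fun hx => ⟨x, hx, rfl⟩) fun hy => ⟨y, hy, rfl⟩
  · intro s hs hl
    obtain ⟨x, rfl⟩ := hSi s hs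
    refine ⟨x, ?_, rfl⟩
    by_contra hx
    exact (hnt x).1 hl (isInterior_of_not_even hr hx)
  · intro s hs
    obtain ⟨x, rfl⟩ := hSi s hs
    by_cases hi : x.IsInterior
    · have := hσ.ncard_leavesAt_add h x
      have := ncard_neighborSet_of_isInterior hr hi
      exact Set.nonempty_of_ncard_ne_zero (by omega)
    · exact ((hnt x).2 hi).nonempty
  · rintro s - s' - t ⟨x, y, rfl, rfl, hxy⟩ ⟨x', y', rfl, hy, hxy'⟩
    have hy := hσ.injective hy
    subst hy
    rw [layeredMatching_right_unique hr hxy.symm hxy'.symm]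
  · rintro _ ⟨x, hx, rfl⟩
    -- A boundary atom uses its own two leaves; an interior one is covered by the matching, and its
    -- partner has odd level, hence lies outside the cover.
    by_cases hi : x.IsInterior
    · obtain ⟨y, hy⟩ := exists_layeredMatching_adj hr hi
      refine .inr ⟨σ y, hσ.mem y, ?_, ⟨x, y, rfl, rfl, hy⟩, ((hσ.adj_iff x y).1 hy.1).2⟩
      rintro ⟨z, hz, hzy⟩
      rw [hσ.injective hzy] at hz
      exact (not_even_iff_of_layeredMatching_adj hr hy).2 hz hx
    · exact .inl ((hnt x).2 hi)

theorem theorem5p2 {V : Type*} [Finite V] (r : ℕ) (hr : 1 ≤ r) (H : SimpleGraph V)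
    (hH : IsHexagonalSilicateSheet r H) :
    H.gpack = H.gt ∧
    (layeredMatching r).IsMatching ∧
    Nonempty (H.smooth ≃g (nanosheet r).attachLeaves (layeredMatching r)) ∧
    Nat.card (NanosheetVertex r) = 6 * r ^ 2 ∧
    ((layeredMatching r).edgeSet.ncard : ℤ) = 3 * ((r : ℤ) ^ 2 - r) ∧
    (H.gt : ℤ) = Nat.card (NanosheetVertex r) - (layeredMatching r).edgeSet.ncard ∧
    (H.gt : ℤ) = 6 * (r : ℤ) ^ 2 - 3 * ((r : ℤ) ^ 2 - r) ∧
    H.gt = 3 * (r ^ 2 + r) := by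
  obtain ⟨Si, h⟩ := hH.1.exists_isSiliconSet
  obtain ⟨φ⟩ := hH.2
  obtain ⟨σ, hσ⟩ := h.exists_isSkeleton φ
  obtain ⟨hpack, hgt⟩ := IsHexagonalSilicateSheet.gpack_eq_and_gt_eq hr h hσ
  have hM : ((layeredMatching r).edgeSet.ncard : ℤ) = 3 * ((r : ℤ) ^ 2 - r) := by
    rw [NanosheetVertex.ncard_layeredMatching_edgeSet hr]
    push_cast [Nat.cast_sub hr]
    ring
  refine ⟨hpack.trans hgt.symm, NanosheetVertex.layeredMatching_isMatching hr,
    hσ.nonempty_iso_attachLeaves h _ ?_ ?_, NanosheetVertex.card_eq hr, hM, ?_, ?_, hgt⟩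
  · exact fun x hx => NanosheetVertex.ncard_neighborSet_of_isInterior hr
      ((NanosheetVertex.mem_layeredMatching_verts_iff hr x).1 hx)
  · exact fun x hx => NanosheetVertex.ncard_neighborSet_of_not_isInterior hr
      fun hi => hx ((NanosheetVertex.mem_layeredMatching_verts_iff hr x).2 hi)
  · rw [hM, hgt, NanosheetVertex.card_eq hr]
    push_cast
    ring
  · rw [hgt]
    push_cast
    ring
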